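/- A signed rooted forest on the vertex set $[n]=\{1,\dots,n\}$ is a rooted forest on $[n]$ (each connected component is a tree with one distinguished vertex, its root) together with a sign $+$ or $-$ on each edge. Two of them are isomorphic if some permutation of $[n]$ maps roots onto roots and edges onto edges, preserving signs. Let $\mathscr{SF}_n$ be the set of isomorphism classes. For a vertex $i$, the operation $r_i$ changes the signs of all edges joining $i$ to its children. Let $\sim$ be the equivalence relation on $\mathscr{SF}_n$ generated by these operations, and put $f_n=|\mathscr{SF}_n/{\sim}|$ for $n\ge 0$ (so $f_0=1$, counting the empty forest) and $\mathscr{F}(x)=\sum_{n\ge 0}f_nx^n\in\mathbb{Q}[[x]]$. Then: (1) $\displaystyle \mathscr{F}(x)=\exp\Bigl(\sum_{k=1}^{\infty}\frac{x^k}{2k}\bigl(\mathscr{F}(x^{2k})+\mathscr{F}(x^k)^2\bigr)\Bigr)$ as formal power series. (2) $\mathscr{F}$ is the only formal power series over $\mathbb{Q}$ that satisfies this functional equation. (3) $f_0,f_1,\dots,f_{10}$ are $1,1,2,5,13,37,111,345,1105,3624,12099$. (4) For every $n\ge 0$, $f_n$ is the number of isomorphism classes of rooted triangular cacti with $2n+1$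 vertices and $n$ triangles. Here a triangular cactus is a connected simple graph in which any two distinct simple cycles have at most one common vertex and every cycle has length three; it is rooted if one vertex is distinguished as the root, and isomorphisms are graph isomorphisms that send the root to the root. -/

import Mathlib

/-- A signed rooted forest with vertex set `{1, …, n}`, modelled as `Fin n`. A root `i` has
`up i = none`; for every other vertex `i`, `up i = some (j, s)` says that `j` is the parent
of `i` and that the edge `{i, j}` carries the sign `s ∈ {1, -1}`. Well-foundedness of the parent
relation says that following parents from any vertex ends at a root. -/
@[ext]
structure SignedRootedForest (n : ℕ) where
  up : Fin n → Option (Fin n × ℤˣ)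
  wf : WellFounded fun p c : Fin n => ∃ s : ℤˣ, up c = some (p, s)

namespace SignedRootedForest

variable {n : ℕ}

/-- `i` is a root of the forest. -/
def IsRoot (T : SignedRootedForest n) (i : Fin n) : Prop := T.up i = none

/-- `{i, j}` is an edge of the forest, with sign `s`. -/
def SignedEdge (T : SignedRootedForest n) (s : ℤˣ) (i j : Fin n) : Prop :=
  T.up i = some (j, s) ∨ T.up j = some (i, s)

/-- Isomorphism of signed rooted forests: a permutation of the vertices that sends the roots to
the roots and the edges to the edges (in both directions), preserving the signs. -/
def Iso (T T' : SignedRootedForest n) : Prop :=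
  ∃ π : Equiv.Perm (Fin n), (∀ i, T.IsRoot i ↔ T'.IsRoot (π i)) ∧
    ∀ s i j, T.SignedEdge s i j ↔ T'.SignedEdge s (π i) (π j)

theorem iso_equivalence : Equivalence (Iso (n := n)) where
  refl T := ⟨Equiv.refl _, fun _ => Iff.rfl, fun _ _ _ => Iff.rfl⟩
  symm := by
    rintro T T' ⟨π, h, h'⟩
    refine ⟨π.symm, fun i => ?_, fun s i j => ?_⟩
    · simpa using (h (π.symm i)).symm
    · simpa using (h' s (π.symm i) (π.symm j)).symm
  trans := by
    rintro T T' T'' ⟨π, h, h'⟩ ⟨ρ, k, k'⟩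
    exact ⟨π.trans ρ, fun i => (h i).trans (k _), fun s i j => (h' s i j).trans (k' _ _ _)⟩

/-- The isomorphism relation as a setoid. -/
def isoSetoid (n : ℕ) : Setoid (SignedRootedForest n) := ⟨Iso, iso_equivalence⟩

/-- The operation `r_i`: change the signs of all edges between `i` and its children. -/
def flip (i : Fin n) (T : SignedRootedForest n) : SignedRootedForest n where
  up c := (T.up c).map fun e => (e.1, if e.1 = i then -e.2 else e.2)
  wf := by
    refine Subrelation.wf ?_ T.wf
    rintro p c ⟨s, hs⟩
    obtain ⟨⟨q, t⟩, hq, he⟩ := Option.map_eq_some_iff.mp hs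
    simp only [Prod.mk.injEq] at he
    exact ⟨t, by rw [hq, he.1]⟩

end SignedRootedForest

/-- The set of isomorphism classes of signed rooted forests on `n` vertices. -/
def SF (n : ℕ) : Type := Quotient (SignedRootedForest.isoSetoid n)

/-- `FlipStep A B`: the class `B` is obtained from the class `A` by some operation `r_i`, applied
to a representative of `A`. -/
def FlipStep {n : ℕ} (A B : SF n) : Prop :=
  ∃ (T : SignedRootedForest n) (i : Fin n),
    A = Quotient.mk (SignedRootedForest.isoSetoid n) T ∧
      B = Quotient.mk (SignedRootedForest.isoSetoid n) (T.flip i)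

/-- The quotient of `SF n` by the equivalence relation generated by the operations `r_i`. -/
def SFClasses (n : ℕ) : Type := Quotient (Relation.EqvGen.setoid (FlipStep (n := n)))

/-- The number of classes of signed rooted forests on `n` vertices. -/
noncomputable def forestClassCount (n : ℕ) : ℕ := Nat.card (SFClasses n)

/-- The generating function `∑ f_n x ^ n`. -/
noncomputable def forestSeries : PowerSeries ℚ :=
  PowerSeries.mk fun n => (forestClassCount n : ℚ)

section FunctionalEquation

open scoped PowerSeries.WithPiTopology

/-- The functional equation `F(x) = exp (∑_{k ≥ 1} x^k / (2k) * (F(x^{2k}) + F(x^k)^2))` for a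
formal power series `F`. The infinite sum of power series converges coefficientwise. -/
def SatisfiesFunctionalEquation (F : PowerSeries ℚ) : Prop :=
  ∃ S : PowerSeries ℚ,
    HasSum (fun k : ℕ+ => (1 / (2 * (k : ℚ))) • ((PowerSeries.X : PowerSeries ℚ) ^ (k : ℕ) *
      (F.subst ((PowerSeries.X : PowerSeries ℚ) ^ (2 * (k : ℕ))) +
        (F.subst ((PowerSeries.X : PowerSeries ℚ) ^ (k : ℕ))) ^ 2))) S ∧
    F = (PowerSeries.exp ℚ).subst S

end FunctionalEquation

/-- A triangular cactus: a connected graph in which two distinct simple cycles have at most one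
common vertex and in which every cycle has length three. -/
def SimpleGraph.IsTriangularCactus {V : Type*} (G : SimpleGraph V) : Prop :=
  G.Connected ∧
  (∀ (u v : V) (p : G.Walk u u) (q : G.Walk v v), p.IsCycle → q.IsCycle →
    p.toSubgraph ≠ q.toSubgraph → (p.toSubgraph.verts ∩ q.toSubgraph.verts).Subsingleton) ∧
  ∀ (u : V) (p : G.Walk u u), p.IsCycle → p.length = 3

/-- A rooted triangular cactus with `2n + 1` (labelled) vertices and `n` triangles. -/
structure RootedTriangularCactus (n : ℕ) where
  graph : SimpleGraph (Fin (2 * n + 1))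
  root : Fin (2 * n + 1)
  isTriangularCactus : graph.IsTriangularCactus
  card_triangles : {t : Finset (Fin (2 * n + 1)) | graph.IsNClique 3 t}.ncard = n

namespace RootedTriangularCactus

variable {n : ℕ}

/-- Isomorphism of rooted cacti: a graph isomorphism that sends the root to the root. -/
def Iso (C D : RootedTriangularCactus n) : Prop := ∃ e : C.graph ≃g D.graph, e C.root = D.root

theorem iso_equivalence : Equivalence (Iso (n := n)) where
  refl C := ⟨SimpleGraph.Iso.refl, rfl⟩
  symm := by
    rintro C D ⟨e, h⟩
    exact ⟨e.symm, by rw [← h]; exact e.symm_apply_apply _⟩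
  trans := by
    rintro C D E ⟨e, h⟩ ⟨e', h'⟩
    exact ⟨e.trans e', by rw [← h', ← h]; rfl⟩

/-- The isomorphism relation as a setoid. -/
def isoSetoid (n : ℕ) : Setoid (RootedTriangularCactus n) := ⟨Iso, iso_equivalence⟩

end RootedTriangularCactus

/-- The number of isomorphism classes of rooted triangular cacti with `2n + 1` vertices and `n`
triangles. -/
noncomputable def rootedTriangularCactusCount (n : ℕ) : ℕ :=
  Nat.card (Quotient (RootedTriangularCactus.isoSetoid n))

/-! Isomorphisms and the operations `r_i` together generate one relation, `Twisted`: relabel the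
vertices by a permutation and, at each vertex `v` with `ε v = -1`, change the signs of the edges to
its children. The signs split the children of a vertex into two sets, and the flip exchanges these
sets. Up to twisting, a forest is therefore a multiset of trees, and a tree is a root with an
unordered pair of forests. `PairForest` is the type of such objects, and `twisted_iff_shape_eq` says
that the `PairForest` of a signed forest is a complete invariant.

Counting unordered pairs gives the tree series T(x) = x (F(x²) + F(x)²) / 2
(`exists_finset_pairSize`). Counting multisets of trees gives n f_n = ∑_j (∑_{d ∣ j} d t_d) f_{n-j}
(`mul_card_multiset`), which is the differentiated form of F = exp(∑ T(x^k) / k). By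
`satisfiesFunctionalEquation_iff` the functional equation is equivalent to this recursion with f_0 =
1. Since t_d involves only f_m with m < d, the recursion has one solution, and the values are
computed from it.

For the cacti, each forest vertex `c` becomes a triangle with two upper vertices `(c, 1)`, `(c, -1)`
and lowest vertex `up c`, where `none` is the root of the cactus. Distances to the root recover the
triangles and their lowest vertices, so rooted isomorphisms of these cacti are exactly twists
(`twisted_iff_cactusGraph_iso`). Every rooted cactus arises in this way (`exists_toCactus_iso`). -/

section Recursion

/-! ### The functional equation as a recursion for coefficients -/

open PowerSeries Finset
open scoped PowerSeries.WithPiTopology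

/-- The series of trees `x (F(x²) + F(x)²) / 2` attached to a series `F` of forests. -/
noncomputable def treeSeries (F : PowerSeries ℚ) : PowerSeries ℚ :=
  (1 / 2 : ℚ) • (X * (F.subst (X ^ 2 : PowerSeries ℚ) + F ^ 2))

/-- The series `∑_{k ≥ 1} T(x^k) / k`, where `T` is the series of trees of `F`. -/
noncomputable def logSeries (F : PowerSeries ℚ) : PowerSeries ℚ :=
  PowerSeries.mk fun n => ∑ d ∈ n.divisors, coeff d (treeSeries F) * (d / n)

/-- The coefficients of the tree series in terms of those of the forest series. -/
def treeCoeff (g : ℕ → ℚ) : ℕ → ℚ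
  | 0 => 0
  | m + 1 => ((if 2 ∣ m then g (m / 2) else 0) + ∑ p ∈ antidiagonal m, g p.1 * g p.2) / 2

/-- The recursion satisfied by the numbers of multisets of trees. -/
def ForestRecursion (g : ℕ → ℚ) : Prop :=
  g 0 = 1 ∧ ∀ n : ℕ, (n + 1) * g (n + 1) =
    ∑ p ∈ antidiagonal n, (∑ d ∈ (p.1 + 1).divisors, d * treeCoeff g d) * g p.2

theorem coeff_treeSeries (F : PowerSeries ℚ) (n : ℕ) :
    coeff n (treeSeries F) = treeCoeff (fun m => coeff m F) n := by
  cases n with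
  | zero => simp [treeSeries, treeCoeff]
  | succ m =>
    rw [treeSeries, treeCoeff, coeff_smul, coeff_succ_X_mul, map_add,
      coeff_subst_X_pow two_ne_zero, pow_two F, coeff_mul, smul_eq_mul, Algebra.algebraMap_self,
      RingHom.id_apply]
    ring

/-- Substituting x^k turns the F(x²) inside T into F(x^{2k}). The sum in the functional equation is
thus ∑ T(x^k) / k. -/
theorem functionalEquation_term (F : PowerSeries ℚ) {k : ℕ} (hk : k ≠ 0) :
    (1 / (2 * (k : ℚ))) • ((X : PowerSeries ℚ) ^ k *
      (F.subst ((X : PowerSeries ℚ) ^ (2 * k)) + (F.subst ((X : PowerSeries ℚ) ^ k)) ^ 2)) =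
    (1 / (k : ℚ)) • (treeSeries F).subst ((X : PowerSeries ℚ) ^ k) := by
  have hs : HasSubst ((X : PowerSeries ℚ) ^ k) := .X_pow hk
  have h2 : HasSubst ((X : PowerSeries ℚ) ^ 2) := .X_pow two_ne_zero
  rw [treeSeries, subst_smul hs, subst_mul hs, subst_X hs, subst_add hs, subst_pow hs,
    subst_comp_subst_apply h2 hs, subst_pow hs, subst_X hs, ← pow_mul, mul_comm k 2, smul_smul]
  congr 1
  field_simp

theorem hasSum_functionalEquation (F : PowerSeries ℚ) :
    HasSum (fun k : ℕ+ => (1 / (2 * (k : ℚ))) • ((X : PowerSeries ℚ) ^ (k : ℕ) *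
      (F.subst ((X : PowerSeries ℚ) ^ (2 * (k : ℕ))) +
        (F.subst ((X : PowerSeries ℚ) ^ (k : ℕ))) ^ 2))) (logSeries F) := by
  rw [WithPiTopology.hasSum_iff_hasSum_coeff]
  intro n
  have hterm : ∀ k : ℕ+, coeff n ((1 / (2 * (k : ℚ))) • ((X : PowerSeries ℚ) ^ (k : ℕ) *
      (F.subst ((X : PowerSeries ℚ) ^ (2 * (k : ℕ))) +
        (F.subst ((X : PowerSeries ℚ) ^ (k : ℕ))) ^ 2))) =
      if (k : ℕ) ∣ n then coeff (n / k) (treeSeries F) / k else 0 := by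
    intro k
    rw [functionalEquation_term F k.ne_zero, map_smul, coeff_subst_X_pow k.ne_zero]
    split_ifs <;> simp [div_eq_inv_mul]
  simp only [hterm, logSeries, coeff_mk]
  -- Every `k` divides `0`, so the support need not be finite here; the terms vanish because T has
  -- no constant term. For `n > 0` only the divisors of `n` contribute.
  rcases Nat.eq_zero_or_pos n with rfl | hn
  · simp [treeSeries, hasSum_zero]
  have hfin : HasSum (fun k : ℕ+ => if (k : ℕ) ∣ n then coeff (n / k) (treeSeries F) / (k : ℚ)
      else 0) (∑ k ∈ (n.divisors).attach.image
        (fun d => (⟨d.1, Nat.pos_of_mem_divisors d.2⟩ : ℕ+)),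
          if (k : ℕ) ∣ n then coeff (n / k) (treeSeries F) / (k : ℚ) else 0) := by
    refine hasSum_sum_of_ne_finset_zero fun k hk => if_neg fun hd => hk ?_
    exact mem_image.2 ⟨⟨k, Nat.mem_divisors.2 ⟨hd, hn.ne'⟩⟩, mem_attach _ _, rfl⟩
  suffices h : (∑ d ∈ n.divisors, coeff d (treeSeries F) * ((d : ℚ) / n)) =
      ∑ k ∈ (n.divisors).attach.image (fun d => (⟨d.1, Nat.pos_of_mem_divisors d.2⟩ : ℕ+)),
        if (k : ℕ) ∣ n then coeff (n / k) (treeSeries F) / (k : ℚ) else 0 by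
    rw [h]
    exact hfin
  rw [sum_image (by
    intro a _ b _ h
    exact Subtype.ext (congrArg PNat.val h))]
  dsimp only
  rw [sum_attach n.divisors (fun k => if k ∣ n then coeff (n / k) (treeSeries F) / (k : ℚ) else 0),
    ← Nat.sum_div_divisors]
  refine sum_congr rfl fun d hd => ?_
  obtain ⟨e, rfl⟩ := Nat.dvd_of_mem_divisors hd
  have hd0 : (d : ℚ) ≠ 0 := by rintro h; simp_all
  have he0 : (e : ℚ) ≠ 0 := by rintro h; simp_all
  rw [if_pos (dvd_mul_right d e), Nat.mul_div_cancel_left e (by exact_mod_cast Nat.pos_of_mem_divisors hd)]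
  push_cast
  field_simp

theorem satisfiesFunctionalEquation_iff_eq_exp (F : PowerSeries ℚ) :
    SatisfiesFunctionalEquation F ↔ F = (exp ℚ).subst (logSeries F) :=
  ⟨fun ⟨_, hS, h⟩ => by rwa [hS.unique (hasSum_functionalEquation F)] at h,
    fun h => ⟨_, hasSum_functionalEquation F, h⟩⟩

/-- A power series `F` is `exp S` if it satisfies the differential equation `F' = S' F`. -/
theorem eq_exp_subst_iff (F S : PowerSeries ℚ) (hS : constantCoeff S = 0) :
    F = (exp ℚ).subst S ↔ coeff 0 F = 1 ∧ ∀ n : ℕ, (n + 1) * coeff (n + 1) F =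
      ∑ p ∈ antidiagonal n, ((p.1 + 1) * coeff (p.1 + 1) S) * coeff p.2 F := by
  have hs : HasSubst S := HasSubst.of_constantCoeff_zero' hS
  have key : ∀ n : ℕ, (n + 1) * coeff (n + 1) ((exp ℚ).subst S) =
      ∑ p ∈ antidiagonal n, ((p.1 + 1) * coeff (p.1 + 1) S) * coeff p.2 ((exp ℚ).subst S) := by
    intro n
    have h := congrArg (coeff n) (derivative_subst (f := exp ℚ) hs)
    rw [derivative_exp, mul_comm, coeff_mul, coeff_derivative, mul_comm] at h
    rw [h]
    refine sum_congr rfl fun p _ => ?_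
    rw [coeff_derivative]
    ring
  have h0 : coeff 0 ((exp ℚ).subst S) = 1 := by
    rw [coeff_zero_eq_constantCoeff_apply]
    refine (constantCoeff_subst hs _).trans ?_
    rw [finsum_eq_single _ 0]
    · simp
    · intro d hd
      change _ • constantCoeff (S ^ d) = 0
      simp [hS, hd]
  constructor
  · rintro h
    rw [h]
    exact ⟨h0, key⟩
  · rintro ⟨hF0, hF⟩
    ext n
    induction n using Nat.strong_induction_on with
    | _ n ih =>
      cases n with
      | zero => rw [hF0, h0]
      | succ n =>
        have hn : ((n : ℚ) + 1) ≠ 0 := by positivity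
        apply mul_left_cancel₀ hn
        rw [hF, key]
        refine sum_congr rfl fun p hp => ?_
        rw [ih p.2 (by have := mem_antidiagonal.1 hp; omega)]

/-- Passing to F' = S' F multiplies the n-th coefficient of S = `logSeries F` by n, which cancels
the denominators and leaves ∑_{d ∣ n} d t_d. -/
theorem satisfiesFunctionalEquation_iff (F : PowerSeries ℚ) :
    SatisfiesFunctionalEquation F ↔ ForestRecursion fun n => coeff n F := by
  have h0 : constantCoeff (logSeries F) = 0 := by
    rw [← coeff_zero_eq_constantCoeff_apply]
    simp [logSeries]
  rw [satisfiesFunctionalEquation_iff_eq_exp, eq_exp_subst_iff F _ h0, ForestRecursion]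
  have hc : ∀ n : ℕ, ((n : ℚ) + 1) * coeff (n + 1) (logSeries F) =
      ∑ d ∈ (n + 1).divisors, d * treeCoeff (fun m => coeff m F) d := by
    intro n
    have hn : ((n : ℚ) + 1) ≠ 0 := by positivity
    rw [logSeries, coeff_mk, mul_sum]
    refine sum_congr rfl fun d _ => ?_
    rw [coeff_treeSeries]
    push_cast
    field_simp
  simp only [hc]

/-- The factor x in T, which stands for the root, makes the n-th tree coefficient depend only on
earlier forest coefficients. Hence the recursion determines its solution. -/
theorem treeCoeff_congr {g h : ℕ → ℚ} {n : ℕ} (hgh : ∀ m < n, g m = h m) :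
    treeCoeff g n = treeCoeff h n := by
  cases n with
  | zero => rfl
  | succ m =>
    simp only [treeCoeff]
    rw [hgh (m / 2) (by omega)]
    congr 2
    refine sum_congr rfl fun p hp => ?_
    have := mem_antidiagonal.1 hp
    rw [hgh p.1 (by omega), hgh p.2 (by omega)]

theorem ForestRecursion.unique {g h : ℕ → ℚ} (hg : ForestRecursion g) (hh : ForestRecursion h)
    (n : ℕ) : g n = h n := by
  induction n using Nat.strong_induction_on with
  | _ n ih =>
    cases n with
    | zero => rw [hg.1, hh.1]
    | succ n =>
      have hn : ((n : ℚ) + 1) ≠ 0 := by positivity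
      apply mul_left_cancel₀ hn
      rw [hg.2, hh.2]
      refine sum_congr rfl fun p hp => ?_
      have := mem_antidiagonal.1 hp
      rw [ih p.2 (by omega)]
      congr 1
      refine sum_congr rfl fun d hd => ?_
      have hd' := Nat.divisor_le hd
      rw [treeCoeff_congr fun m hm => ih m (by omega)]

/-- The computation alternates: `treeCoeff g n` comes from the values of `g` below `n`, and then `g
n` comes from the tree coefficients up to `n`. -/
theorem ForestRecursion.values {g : ℕ → ℚ} (hg : ForestRecursion g) :
    g 0 = 1 ∧ g 1 = 1 ∧ g 2 = 2 ∧ g 3 = 5 ∧ g 4 = 13 ∧ g 5 = 37 ∧ g 6 = 111 ∧ g 7 = 345 ∧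
      g 8 = 1105 ∧ g 9 = 3624 ∧ g 10 = 12099 := by
  obtain ⟨h0, hg⟩ := hg
  have d1 : Nat.divisors 1 = {1} := by decide
  have d2 : Nat.divisors 2 = {1, 2} := by decide
  have d3 : Nat.divisors 3 = {1, 3} := by decide
  have d4 : Nat.divisors 4 = {1, 2, 4} := by decide
  have d5 : Nat.divisors 5 = {1, 5} := by decide
  have d6 : Nat.divisors 6 = {1, 2, 3, 6} := by decide
  have d7 : Nat.divisors 7 = {1, 7} := by decide
  have d8 : Nat.divisors 8 = {1, 2, 4, 8} := by decide
  have d9 : Nat.divisors 9 = {1, 3, 9} := by decide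
  have d10 : Nat.divisors 10 = {1, 2, 5, 10} := by decide
  simp only [Nat.sum_antidiagonal_eq_sum_range_succ_mk] at hg
  have t1 : treeCoeff g 1 = 1 := by norm_num [treeCoeff, h0]
  have h1 : g 1 = 1 := by
    have := hg 0
    norm_num [sum_range_succ, d1, t1, h0] at this
    linarith
  have t2 : treeCoeff g 2 = 1 := by
    norm_num [treeCoeff, Nat.sum_antidiagonal_eq_sum_range_succ_mk, sum_range_succ, h0, h1]
  have h2 : g 2 = 2 := by
    have := hg 1
    norm_num [sum_range_succ, d1, d2, t1, t2, h0, h1] at this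
    linarith
  have t3 : treeCoeff g 3 = 3 := by
    norm_num [treeCoeff, Nat.sum_antidiagonal_eq_sum_range_succ_mk, sum_range_succ, h0, h1, h2]
  have h3 : g 3 = 5 := by
    have := hg 2
    norm_num [sum_range_succ, d1, d2, d3, t1, t2, t3, h0, h1, h2] at this
    linarith
  have t4 : treeCoeff g 4 = 7 := by
    norm_num [treeCoeff, Nat.sum_antidiagonal_eq_sum_range_succ_mk, sum_range_succ, h0, h1, h2, h3]
  have h4 : g 4 = 13 := by
    have := hg 3
    norm_num [sum_range_succ, d1, d2, d3, d4, t1, t2, t3, t4, h0, h1, h2, h3] at this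
    linarith
  have t5 : treeCoeff g 5 = 21 := by
    norm_num [treeCoeff, Nat.sum_antidiagonal_eq_sum_range_succ_mk, sum_range_succ, h0, h1, h2, h3,
      h4]
  have h5 : g 5 = 37 := by
    have := hg 4
    norm_num [sum_range_succ, d1, d2, d3, d4, d5, t1, t2, t3, t4, t5, h0, h1, h2, h3, h4] at this
    linarith
  have t6 : treeCoeff g 6 = 60 := by
    norm_num [treeCoeff, Nat.sum_antidiagonal_eq_sum_range_succ_mk, sum_range_succ, h0, h1, h2, h3,
      h4, h5]
  have h6 : g 6 = 111 := by
    have := hg 5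
    norm_num [sum_range_succ, d1, d2, d3, d4, d5, d6, t1, t2, t3, t4, t5, t6, h0, h1, h2, h3, h4,
      h5] at this
    linarith
  have t7 : treeCoeff g 7 = 189 := by
    norm_num [treeCoeff, Nat.sum_antidiagonal_eq_sum_range_succ_mk, sum_range_succ, h0, h1, h2, h3,
      h4, h5, h6]
  have h7 : g 7 = 345 := by
    have := hg 6
    norm_num [sum_range_succ, d1, d2, d3, d4, d5, d6, d7, t1, t2, t3, t4, t5, t6, t7, h0, h1, h2,
      h3, h4, h5, h6] at this
    linarith
  have t8 : treeCoeff g 8 = 595 := by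
    norm_num [treeCoeff, Nat.sum_antidiagonal_eq_sum_range_succ_mk, sum_range_succ, h0, h1, h2, h3,
      h4, h5, h6, h7]
  have h8 : g 8 = 1105 := by
    have := hg 7
    norm_num [sum_range_succ, d1, d2, d3, d4, d5, d6, d7, d8, t1, t2, t3, t4, t5, t6, t7, t8, h0,
      h1, h2, h3, h4, h5, h6, h7] at this
    linarith
  have t9 : treeCoeff g 9 = 1948 := by
    norm_num [treeCoeff, Nat.sum_antidiagonal_eq_sum_range_succ_mk, sum_range_succ, h0, h1, h2, h3,
      h4, h5, h6, h7, h8]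
  have h9 : g 9 = 3624 := by
    have := hg 8
    norm_num [sum_range_succ, d1, d2, d3, d4, d5, d6, d7, d8, d9, t1, t2, t3, t4, t5, t6, t7, t8,
      t9, h0, h1, h2, h3, h4, h5, h6, h7, h8] at this
    linarith
  have t10 : treeCoeff g 10 = 6455 := by
    norm_num [treeCoeff, Nat.sum_antidiagonal_eq_sum_range_succ_mk, sum_range_succ, h0, h1, h2, h3,
      h4, h5, h6, h7, h8, h9]
  have h10 : g 10 = 12099 := by
    have := hg 9
    norm_num [sum_range_succ, d1, d2, d3, d4, d5, d6, d7, d8, d9, d10, t1, t2, t3, t4, t5, t6, t7,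
      t8, t9, t10, h0, h1, h2, h3, h4, h5, h6, h7, h8, h9] at this
    linarith
  exact ⟨h0, h1, h2, h3, h4, h5, h6, h7, h8, h9, h10⟩

end Recursion


/-! ### Twisting: isomorphisms and flips as one relation -/

/-- Relabel a vertex along `f`, after multiplying its sign with the value of `ε`. -/
def twist {V W : Type*} (f : V → W) (ε : V → ℤˣ) : Option (V × ℤˣ) → Option (W × ℤˣ) :=
  Option.map fun e => (f e.1, ε e.1 * e.2)

section Twist

variable {V W : Type*} (f : V → W) (ε : V → ℤˣ)

@[simp] theorem twist_none : twist f ε none = none := rfl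

@[simp] theorem twist_some (p : V) (s : ℤˣ) : twist f ε (some (p, s)) = some (f p, ε p * s) := rfl

theorem twist_eq_none {o : Option (V × ℤˣ)} : twist f ε o = none ↔ o = none := by
  cases o <;> simp [twist]

theorem twist_injective {f : V → W} (hf : Function.Injective f) :
    Function.Injective (twist f ε) := by
  refine Option.map_injective ?_
  rintro ⟨p, s⟩ ⟨q, t⟩ h
  simp only [Prod.mk.injEq] at h
  obtain rfl := hf h.1
  simpa using h.2

end Twist

namespace SignedRootedForest

variable {n : ℕ}

/-- The number of vertices on the path from a vertex to its root. -/
noncomputable def height (T : SignedRootedForest n) : Fin n → ℕ :=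
  T.wf.fix fun c rec => match h : T.up c with
    | none => 1
    | some (p, s) => rec p ⟨s, h⟩ + 1

theorem height_of_root (T : SignedRootedForest n) {c : Fin n} (h : T.up c = none) :
    T.height c = 1 := by
  rw [height, WellFounded.fix_eq]
  split
  · rfl
  · simp_all

theorem height_of_up (T : SignedRootedForest n) {c p : Fin n} {s : ℤˣ}
    (h : T.up c = some (p, s)) : T.height c = T.height p + 1 := by
  rw [height, WellFounded.fix_eq]
  split
  · simp_all
  · rename_i q t h'
    rw [h] at h'
    cases h'
    rfl

/-- Two forests are twisted copies of each other if some relabelling maps one to the other up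
to changing, for some of the vertices, the signs of all edges to the children. -/
def Twisted (T T' : SignedRootedForest n) : Prop :=
  ∃ (π : Equiv.Perm (Fin n)) (ε : Fin n → ℤˣ), ∀ c, T'.up (π c) = twist π ε (T.up c)

/-- An isomorphism preserves undirected edges; their direction is recovered by induction from the
roots. If the image of `p` had the image of its child `c` as parent, then by induction `c` would
also be the parent of `p`, which the heights forbid. -/
theorem Iso.map_up {T T' : SignedRootedForest n} {π : Equiv.Perm (Fin n)}
    (hr : ∀ i, T.IsRoot i ↔ T'.IsRoot (π i))
    (he : ∀ s i j, T.SignedEdge s i j ↔ T'.SignedEdge s (π i) (π j)) (c : Fin n) :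
    T'.up (π c) = twist π (fun _ => 1) (T.up c) := by
  induction c using T.wf.induction with
  | _ c ih =>
    rcases h : T.up c with _ | ⟨p, s⟩
    · exact (hr c).1 h
    · rw [twist_some, one_mul]
      rcases (he s c p).1 (Or.inl h) with h' | h'
      · exact h'
      · exfalso
        have hp := ih p ⟨s, h⟩
        rcases h'' : T.up p with _ | ⟨q, t⟩
        · rw [h'', h'] at hp
          simp at hp
        · rw [h'', h', twist_some, Option.some.injEq, Prod.mk.injEq] at hp
          obtain rfl := π.injective hp.1
          have h1 := T.height_of_up h
          have h2 := T.height_of_up h''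
          omega

theorem Iso.twisted {T T' : SignedRootedForest n} (h : T.Iso T') : T.Twisted T' := by
  obtain ⟨π, hr, he⟩ := h
  exact ⟨π, _, Iso.map_up hr he⟩

theorem up_flip (i : Fin n) (T : SignedRootedForest n) (c : Fin n) :
    (T.flip i).up c = twist id (fun j => if j = i then -1 else 1) (T.up c) := by
  change (T.up c).map _ = (T.up c).map _
  congr 1
  funext e
  split_ifs <;> simp_all

theorem twisted_flip (i : Fin n) (T : SignedRootedForest n) : T.Twisted (T.flip i) :=
  ⟨Equiv.refl _, _, up_flip i T⟩

/-- The class of a signed rooted forest up to isomorphism and the operations `r_i`. -/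
def toClass (T : SignedRootedForest n) : SFClasses n :=
  Quotient.mk _ (Quotient.mk (isoSetoid n) T)

theorem toClass_flip (i : Fin n) (T : SignedRootedForest n) : (T.flip i).toClass = T.toClass :=
  (Quotient.sound (Relation.EqvGen.rel _ _ ⟨T, i, rfl, rfl⟩)).symm

theorem Iso.toClass_eq {T T' : SignedRootedForest n} (h : T.Iso T') :
    T.toClass = T'.toClass :=
  congrArg (Quotient.mk _) (Quotient.sound h)

theorem iso_of_map_up {T T' : SignedRootedForest n} (π : Equiv.Perm (Fin n))
    (h : ∀ c, T'.up (π c) = twist π (fun _ => 1) (T.up c)) : T.Iso T' := by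
  have key : ∀ s i j, T'.up (π i) = some (π j, s) ↔ T.up i = some (j, s) := by
    intro s i j
    rw [h, show some (π j, s) = twist π (fun _ => 1) (some (j, s)) by simp,
      (twist_injective _ π.injective).eq_iff]
  refine ⟨π, fun i => ?_, fun s i j => ?_⟩
  · rw [IsRoot, IsRoot, h, twist_eq_none]
  · rw [SignedEdge, SignedEdge, key, key]

theorem exists_flip_finset (T : SignedRootedForest n) (s : Finset (Fin n)) :
    ∃ T' : SignedRootedForest n, T'.toClass = T.toClass ∧
      ∀ c, T'.up c = twist id (fun i => if i ∈ s then -1 else 1) (T.up c) := by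
  induction s using Finset.induction_on with
  | empty => exact ⟨T, rfl, fun c => by rcases T.up c with _ | ⟨p, t⟩ <;> simp⟩
  | insert a s ha ih =>
    obtain ⟨T', hT', h⟩ := ih
    refine ⟨T'.flip a, (toClass_flip a T').trans hT', fun c => ?_⟩
    rw [up_flip, h]
    rcases T.up c with _ | ⟨p, t⟩
    · rfl
    · by_cases hp : p = a
      · subst hp
        simp [ha]
      · simp [hp]

/-- A twist is a succession of flips at the vertices with `ε i = -1`, followed by a relabelling that
preserves signs. -/
theorem Twisted.toClass_eq {T T' : SignedRootedForest n} (h : T.Twisted T') :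
    T.toClass = T'.toClass := by
  obtain ⟨π, ε, h⟩ := h
  obtain ⟨T'', hT'', h'⟩ := T.exists_flip_finset (Finset.univ.filter fun i => ε i = -1)
  rw [← hT'']
  refine (iso_of_map_up π fun c => ?_).toClass_eq
  rw [h, h']
  rcases T.up c with _ | ⟨p, t⟩
  · rfl
  · rcases Int.units_eq_one_or (ε p) with hp | hp <;> simp [hp]

/-- An invariant of forests under twisting is an invariant of the classes. -/
def liftClass {α : Sort*} (f : SignedRootedForest n → α)
    (hf : ∀ T T', T.Twisted T' → f T = f T') : SFClasses n → α :=
  Quotient.lift (Quotient.lift f fun T T' h => hf T T' (Iso.twisted h)) (by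
    intro A B h
    induction h with
    | rel A B h =>
      obtain ⟨T, i, rfl, rfl⟩ := h
      exact hf _ _ (twisted_flip i T)
    | refl => rfl
    | symm _ _ _ ih => exact ih.symm
    | trans _ _ _ _ _ ih ih' => exact ih.trans ih')

theorem toClass_surjective : Function.Surjective (toClass (n := n)) := by
  rintro ⟨⟨T⟩⟩
  exact ⟨T, rfl⟩

/-- A complete invariant of forests up to twisting that takes all its values counts the classes. -/
theorem forestClassCount_eq_card {α : Type*} (f : SignedRootedForest n → α)
    (hf : ∀ T T', T.Twisted T' ↔ f T = f T') (hsurj : Function.Surjective f) :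
    forestClassCount n = Nat.card α := by
  refine Nat.card_congr (Equiv.ofBijective (liftClass f fun T T' => (hf T T').1) ⟨?_, ?_⟩)
  · intro A B h
    obtain ⟨T, rfl⟩ := toClass_surjective A
    obtain ⟨T', rfl⟩ := toClass_surjective B
    exact ((hf T T').2 h).toClass_eq
  · intro a
    obtain ⟨T, rfl⟩ := hsurj a
    exact ⟨T.toClass, rfl⟩

end SignedRootedForest


/-! ### Unlabelled forests: a type equivalent to `Multiset (Sym2 _)` of itself -/

/-- Terms for forests with unordered pairs of forests below each root: `cons l r t` adds to the
forest `t` a root with the pair `{l, r}` below it. -/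
inductive ForestTerm
  | nil : ForestTerm
  | cons (l r t : ForestTerm) : ForestTerm

namespace ForestTerm

/-- Equality of terms up to the order of the roots and of the two forests below each vertex. -/
inductive Rel : ForestTerm → ForestTerm → Prop
  | refl (x) : Rel x x
  | symm {x y} : Rel x y → Rel y x
  | trans {x y z} : Rel x y → Rel y z → Rel x z
  | cons {l r t l' r' t'} : Rel l l' → Rel r r' → Rel t t' → Rel (cons l r t) (cons l' r' t')
  | comm (l r t) : Rel (cons l r t) (cons r l t)
  | swap (l r l' r' t) : Rel (cons l r (cons l' r' t)) (cons l' r' (cons l r t))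

instance setoid : Setoid ForestTerm := ⟨Rel, Rel.refl, Rel.symm, Rel.trans⟩

/-- The number of vertices. -/
def size : ForestTerm → ℕ
  | nil => 0
  | cons l r t => l.size + r.size + 1 + t.size

theorem Rel.size_eq {x y : ForestTerm} (h : Rel x y) : x.size = y.size := by
  induction h with
  | refl => rfl
  | symm _ ih => exact ih.symm
  | trans _ _ ih ih' => exact ih.trans ih'
  | cons _ _ _ ih ih' ih'' => simp [size, ih, ih', ih'']
  | comm => simp only [size]; omega
  | swap => simp only [size]; omega

end ForestTerm

/-- The type of finite multisets of trees in which an unordered pair of such multisets is attached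
to each vertex. -/
def PairForest : Type := Quotient ForestTerm.setoid

namespace PairForest

/-- The forest of a term. -/
def mk (x : ForestTerm) : PairForest := Quotient.mk _ x

theorem mk_eq {x y : ForestTerm} (h : ForestTerm.Rel x y) : mk x = mk y := Quotient.sound h

/-- The empty forest. -/
def nil : PairForest := mk .nil

/-- Add a root with the pair `{l, r}` below it. -/
noncomputable def cons (l r t : PairForest) : PairForest := mk (.cons l.out r.out t.out)

/-- `Rel` is a congruence, so the representatives chosen in `cons` do not matter. -/
theorem mk_cons (l r t : ForestTerm) :
    mk (.cons l r t) = cons (mk l) (mk r) (mk t) :=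
  Quotient.sound (.cons (.symm (Quotient.mk_out l)) (.symm (Quotient.mk_out r))
    (.symm (Quotient.mk_out t)))

@[elab_as_elim]
theorem induction {P : PairForest → Prop} (h0 : P nil)
    (h : ∀ l r t, P l → P r → P t → P (cons l r t)) (q : PairForest) : P q := by
  obtain ⟨x⟩ := q
  change P (mk x)
  induction x with
  | nil => exact h0
  | cons l r t hl hr ht =>
    rw [mk_cons]
    exact h _ _ _ hl hr ht

theorem cons_comm (l r t : PairForest) : cons l r t = cons r l t := by
  obtain ⟨l⟩ := l
  obtain ⟨r⟩ := r
  obtain ⟨t⟩ := t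
  exact (mk_cons l r t).symm.trans ((mk_eq (.comm l r t)).trans (mk_cons r l t))

theorem cons_swap (l r l' r' t : PairForest) :
    cons l r (cons l' r' t) = cons l' r' (cons l r t) := by
  obtain ⟨l⟩ := l
  obtain ⟨r⟩ := r
  obtain ⟨l'⟩ := l'
  obtain ⟨r'⟩ := r'
  obtain ⟨t⟩ := t
  have := mk_eq (.swap l r l' r' t)
  rw [mk_cons, mk_cons, mk_cons, mk_cons] at this
  exact this

/-- Add a root with a given unordered pair of forests below it. -/
noncomputable def consPair (p : Sym2 PairForest) (t : PairForest) : PairForest :=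
  Sym2.lift ⟨fun l r => cons l r t, fun l r => cons_comm l r t⟩ p

@[simp] theorem consPair_mk (l r t : PairForest) : consPair s(l, r) t = cons l r t := rfl

/-- The order of the roots is irrelevant, which makes the fold over a multiset in `ofMultiset` well
defined. -/
instance : LeftCommutative consPair where
  left_comm p q t := by
    induction p with
    | _ l r =>
      induction q with
      | _ l' r' => exact cons_swap l r l' r' t

/-- The number of vertices. -/
def size : PairForest → ℕ := Quotient.lift ForestTerm.size fun _ _ h => h.size_eq

@[simp] theorem size_nil : size nil = 0 := rfl

@[simp] theorem size_cons (l r t : PairForest) :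
    size (cons l r t) = size l + size r + 1 + size t := by
  obtain ⟨l⟩ := l
  obtain ⟨r⟩ := r
  obtain ⟨t⟩ := t
  exact congrArg size (mk_cons l r t).symm

/-- The number of vertices of a tree whose root has the given pair of forests below it. -/
def pairSize : Sym2 PairForest → ℕ :=
  Sym2.lift ⟨fun l r => size l + size r + 1, fun l r => by dsimp only; rw [Nat.add_comm l.size]⟩

@[simp] theorem pairSize_mk (l r : PairForest) : pairSize s(l, r) = size l + size r + 1 := rfl

theorem size_consPair (p : Sym2 PairForest) (t : PairForest) :
    size (consPair p t) = pairSize p + size t := by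
  induction p with
  | _ l r => simp

/-- The forest with a given multiset of trees. -/
noncomputable def ofMultiset : Multiset (Sym2 PairForest) → PairForest :=
  Multiset.foldr consPair nil

@[simp] theorem ofMultiset_zero : ofMultiset 0 = nil := rfl

@[simp] theorem ofMultiset_cons (p : Sym2 PairForest) (m : Multiset (Sym2 PairForest)) :
    ofMultiset (p ::ₘ m) = consPair p (ofMultiset m) := Multiset.foldr_cons _ _ _ _

theorem size_ofMultiset (m : Multiset (Sym2 PairForest)) :
    size (ofMultiset m) = (m.map pairSize).sum := by
  induction m using Multiset.induction_on with
  | empty => rfl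
  | cons p m ih => rw [ofMultiset_cons, size_consPair, ih, Multiset.map_cons, Multiset.sum_cons]

/-- The multiset of trees of a term. -/
def termTrees : ForestTerm → Multiset (Sym2 PairForest)
  | .nil => 0
  | .cons l r t => s(mk l, mk r) ::ₘ termTrees t

/-- Exchanging two roots is invisible in a multiset, exchanging the forests below a root is
invisible in `Sym2`, and changes inside those forests are absorbed by `mk`. -/
theorem termTrees_eq {x y : ForestTerm} (h : ForestTerm.Rel x y) : termTrees x = termTrees y := by
  induction h with
  | refl => rfl
  | symm _ ih => exact ih.symm
  | trans _ _ ih ih' => exact ih.trans ih'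
  | cons hl hr _ _ _ ih =>
    rw [termTrees, termTrees, ih, mk_eq hl, mk_eq hr]
  | comm => rw [termTrees, termTrees, Sym2.eq_swap]
  | swap => exact Multiset.cons_swap _ _ _

/-- The multiset of trees of a forest. -/
def trees : PairForest → Multiset (Sym2 PairForest) :=
  Quotient.lift termTrees fun _ _ => termTrees_eq

@[simp] theorem trees_nil : trees nil = 0 := rfl

@[simp] theorem trees_cons (l r t : PairForest) : trees (cons l r t) = s(l, r) ::ₘ trees t := by
  obtain ⟨l⟩ := l
  obtain ⟨r⟩ := r
  obtain ⟨t⟩ := t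
  exact congrArg trees (mk_cons l r t).symm

theorem trees_consPair (p : Sym2 PairForest) (t : PairForest) :
    trees (consPair p t) = p ::ₘ trees t := by
  induction p with
  | _ l r => simp

/-- A forest is the same as a multiset of trees. -/
noncomputable def equivMultiset : PairForest ≃ Multiset (Sym2 PairForest) where
  toFun := trees
  invFun := ofMultiset
  left_inv q := by
    induction q using induction with
    | h0 => rfl
    | h l r t _ _ ht => rw [trees_cons, ofMultiset_cons, ht, consPair_mk]
  right_inv m := by
    induction m using Multiset.induction_on with
    | empty => rfl
    | cons p m ih => rw [ofMultiset_cons, trees_consPair, ih]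

theorem ofMultiset_injective : Function.Injective ofMultiset := equivMultiset.symm.injective

end PairForest


/-! ### Matching equal multisets; recursion along parent functions -/

open Classical in
theorem Finset.count_map_val {α γ : Type*} (S : Finset α) (f : α → γ) (c : γ) :
    (S.val.map f).count c = Fintype.card {x : S // f x = c} := by
  rw [Multiset.count_map, Fintype.card_subtype, ← Finset.filter_val, Finset.card_val,
    ← Finset.card_map (Function.Embedding.subtype _)]
  congr 1
  ext x
  simp [eq_comm, and_comm]

open Classical in
/-- Multisets of values of two functions on finite sets agree only if the sets match. -/
theorem Finset.exists_equiv_of_map_eq {α β γ : Type*} {S : Finset α} {T : Finset β} {f : α → γ}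
    {g : β → γ} (h : S.val.map f = T.val.map g) : ∃ e : S ≃ T, ∀ x : S, g (e x) = f x := by
  -- Equal multiplicities make the two fibres over each value equinumerous; bijections of the fibres
  -- are then glued.
  have hfib : ∀ c : γ, Nonempty ({x : S // f x = c} ≃ {y : T // g y = c}) := by
    intro c
    refine Fintype.card_eq.1 ?_
    rw [← S.count_map_val f, ← T.count_map_val g, h]
  exact ⟨Equiv.ofFiberEquiv fun c => (hfib c).some,
    fun x => Equiv.ofFiberEquiv_map (f := fun x : S => f x) (g := fun y : T => g y) _ x⟩

/-- A function `up` on the vertices is a parent function if it increases some depth. -/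
def IsParentFun {V : Type*} (up : V → Option (V × ℤˣ)) : Prop :=
  ∃ d : V → ℕ, ∀ c p s, up c = some (p, s) → d p < d c

theorem SignedRootedForest.isParentFun {n : ℕ} (T : SignedRootedForest n) : IsParentFun T.up :=
  ⟨T.height, fun _ _ _ h => by rw [T.height_of_up h]; exact Nat.lt_succ_self _⟩

theorem IsParentFun.wf {V : Type*} {up : V → Option (V × ℤˣ)} (h : IsParentFun up) :
    WellFounded fun p c : V => ∃ s : ℤˣ, up c = some (p, s) := by
  obtain ⟨d, hd⟩ := h
  exact Subrelation.wf (fun ⟨s, hs⟩ => hd _ _ s hs) (measure d).wf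

/-- This allows recursion from the leaves down to the roots: depths are bounded by some `B`, so `B -
d` decreases towards the children. The value `B + 1` puts `none`, the common parent of all roots,
above everything. -/
theorem IsParentFun.wf_child {V : Type*} [Finite V] {up : V → Option (V × ℤˣ)}
    (h : IsParentFun up) :
    WellFounded fun o' o : Option (V × ℤˣ) => ∃ c s, o' = some (c, s) ∧ up c = o := by
  obtain ⟨d, hd⟩ := h
  obtain ⟨B, hB⟩ := (Set.finite_range d).bddAbove
  have hB' : ∀ v, d v ≤ B := fun v => hB ⟨v, rfl⟩
  refine Subrelation.wf ?_ (measure fun o : Option (V × ℤˣ) =>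
    o.elim (B + 1) fun e => B - d e.1).wf
  rintro _ (_ | ⟨p, t⟩) ⟨c, s, rfl, hc⟩
  · change B - d c < B + 1
    omega
  · change B - d c < B - d p
    have := hd c p t hc
    have := hB' c
    omega

theorem IsParentFun.induction {V : Type*} [Finite V] {up : V → Option (V × ℤˣ)}
    (h : IsParentFun up) {P : Option (V × ℤˣ) → Prop}
    (hP : ∀ o, (∀ c s, up c = o → P (some (c, s))) → P o) (o : Option (V × ℤˣ)) : P o := by
  induction o using h.wf_child.induction with
  | _ o ih => exact hP o fun c s hc => ih _ ⟨c, s, rfl, hc⟩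

/-! ### The unlabelled forest is a complete invariant under twisting -/

namespace PairForest

section Shape

variable {V : Type*}

/-- The pair of forests below a vertex, if `F` gives the forest below each signed vertex. -/
def pairAt (F : Option (V × ℤˣ) → PairForest) (v : V) : Sym2 PairForest :=
  s(F (some (v, 1)), F (some (v, -1)))

/-- The sign `η` either keeps or exchanges the two forests below a vertex, and an unordered pair
does not see this. The next lemma is the converse: the way in which two equal pairs match determines
a sign. -/
theorem pairAt_eq_of_units {W : Type*} {F : Option (V × ℤˣ) → PairForest}
    {F' : Option (W × ℤˣ) → PairForest} {v : V} {w : W} (η : ℤˣ)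
    (h : ∀ s, F' (some (w, η * s)) = F (some (v, s))) : pairAt F' w = pairAt F v := by
  rw [pairAt, pairAt, ← h, ← h]
  rcases Int.units_eq_one_or η with rfl | rfl
  · simp
  · rw [Sym2.eq_swap]
    simp

theorem exists_units_of_pairAt_eq {W : Type*} {F : Option (V × ℤˣ) → PairForest}
    {F' : Option (W × ℤˣ) → PairForest} {v : V} {w : W} (h : pairAt F' w = pairAt F v) :
    ∃ η : ℤˣ, ∀ s, F' (some (w, η * s)) = F (some (v, s)) := by
  rw [pairAt, pairAt, Sym2.eq_iff] at h
  rcases h with ⟨h1, h2⟩ | ⟨h1, h2⟩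
  · refine ⟨1, fun s => ?_⟩
    rcases Int.units_eq_one_or s with rfl | rfl <;> simpa
  · refine ⟨-1, fun s => ?_⟩
    rcases Int.units_eq_one_or s with rfl | rfl <;> simpa

variable [Fintype V]

open Classical in
/-- The vertices `c` with `up c = o`. -/
noncomputable def children (up : V → Option (V × ℤˣ)) (o : Option (V × ℤˣ)) : Finset V :=
  Finset.univ.filter fun c => up c = o

@[simp] theorem mem_children {up : V → Option (V × ℤˣ)} {o : Option (V × ℤˣ)} {c : V} :
    c ∈ children up o ↔ up c = o := by
  simp [children]

/-- `F` gives the forests below the signed vertices (and the whole forest at `none`). -/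
def IsShape (up : V → Option (V × ℤˣ)) (F : Option (V × ℤˣ) → PairForest) : Prop :=
  ∀ o, F o = ofMultiset ((children up o).val.map (pairAt F))

/-- The equation at `o` involves `F` only at the two signed copies of each child, so recursion along
`wf_child` solves it. -/
theorem exists_isShape {up : V → Option (V × ℤˣ)} (h : IsParentFun up) :
    ∃ F, IsShape up F := by
  refine ⟨h.wf_child.fix fun o rec => ofMultiset ((children up o).attach.val.map fun c =>
    s(rec (some (c.1, 1)) ⟨c.1, 1, rfl, mem_children.1 c.2⟩,
      rec (some (c.1, -1)) ⟨c.1, -1, rfl, mem_children.1 c.2⟩)), fun o => ?_⟩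
  rw [WellFounded.fix_eq, Finset.attach_val]
  exact congrArg ofMultiset (Multiset.attach_map_val' _ (pairAt _))

variable {W : Type*} [Fintype W] {up : V → Option (V × ℤˣ)} {up' : W → Option (W × ℤˣ)}
  {F : Option (V × ℤˣ) → PairForest} {F' : Option (W × ℤˣ) → PairForest}

theorem IsShape.eq_of_children_map (hF : IsShape up F) (hF' : IsShape up' F') (f : V ↪ W)
    {o : Option (V × ℤˣ)} {o' : Option (W × ℤˣ)} (hc : children up' o' = (children up o).map f)
    (hp : ∀ c, up c = o → pairAt F' (f c) = pairAt F c) : F' o' = F o := by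
  rw [hF, hF', hc, Finset.map_val, Multiset.map_map]
  congr 1
  exact Multiset.map_congr rfl fun c h => hp c (mem_children.1 h)

/-- The forest below a signed vertex depends only on its descendants, so an embedding that matches
children up to `ε` preserves it. This serves both for permutations and for the parts of a composed
forest. -/
theorem IsShape.eq_of_embedding (hup : IsParentFun up) (hF : IsShape up F)
    (hF' : IsShape up' F') (f : V ↪ W) (ε : V → ℤˣ)
    (h : ∀ p s, children up' (some (f p, ε p * s)) = (children up (some (p, s))).map f) (v : V)
    (s : ℤˣ) : F' (some (f v, ε v * s)) = F (some (v, s)) := by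
  suffices H : ∀ o : Option (V × ℤˣ), ∀ v s, o = some (v, s) →
      F' (some (f v, ε v * s)) = F (some (v, s)) from H _ v s rfl
  intro o
  induction o using hup.induction with
  | hP o ih =>
    rintro v s rfl
    refine hF.eq_of_children_map hF' f (h v s) fun c hc => ?_
    exact pairAt_eq_of_units (ε c) fun t => ih c t hc c t rfl

theorem IsShape.eq_of_twist (hup : IsParentFun up) (hF : IsShape up F) (hF' : IsShape up' F')
    (π : V ≃ W) (ε : V → ℤˣ) (h : ∀ c, up' (π c) = twist π ε (up c)) : F' none = F none := by
  have hc : ∀ o, children up' (twist π ε o) = (children up o).map π.toEmbedding := by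
    intro o
    ext w
    obtain ⟨c, rfl⟩ := π.surjective w
    rw [mem_children, h, (twist_injective ε π.injective).eq_iff]
    simp
  refine hF.eq_of_children_map hF' π.toEmbedding (hc none) fun c _ => ?_
  exact pairAt_eq_of_units (ε c)
    (hF.eq_of_embedding hup hF' π.toEmbedding ε (fun p s => hc (some (p, s))) c)

/-- The twist is built from the roots upwards. Where two forests agree, the children can be matched
so that their pairs agree; where two pairs agree, a sign matches the forests of the pair. The image
of a vertex is thus chosen once the image of its parent is known. -/
theorem IsShape.exists_twist (hup : IsParentFun up) (hF : IsShape up F) (hF' : IsShape up' F')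
    (hcard : Fintype.card V = Fintype.card W) (h : F' none = F none) :
    ∃ (π : V ≃ W) (ε : V → ℤˣ), ∀ c, up' (π c) = twist π ε (up c) := by
  rcases isEmpty_or_nonempty V with hV | hV
  · exact ⟨Fintype.equivOfCardEq hcard, fun _ => 1, fun c => hV.elim c⟩
  have hW : Nonempty W := Fintype.card_pos_iff.1 (hcard ▸ Fintype.card_pos)
  -- `E o o'` matches the children of `o` with those of `o'` when the forests agree. Junk values
  -- elsewhere make it a total function, so that the recursion for `Φ` carries no proofs; the same
  -- holds for `η`.
  have hE : ∀ o o', ∃ e : V → W, F' o' = F o →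
      (∀ c, up c = o → up' (e c) = o' ∧ pairAt F' (e c) = pairAt F c) ∧
        ∀ c d, up c = o → up d = o → e c = e d → c = d := by
    intro o o'
    by_cases hoo : F' o' = F o
    · have hm := hoo
      rw [hF, hF'] at hm
      obtain ⟨e, he⟩ := Finset.exists_equiv_of_map_eq (ofMultiset_injective hm).symm
      classical
      refine ⟨fun c => if hc : c ∈ children up o then e ⟨c, hc⟩ else hW.some, fun _ => ⟨?_, ?_⟩⟩
      · intro c hc
        dsimp only
        rw [dif_pos (mem_children.2 hc)]
        exact ⟨mem_children.1 (e _).2, he _⟩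
      · intro c d hc hd hcd
        dsimp only at hcd
        rw [dif_pos (mem_children.2 hc), dif_pos (mem_children.2 hd)] at hcd
        exact congrArg Subtype.val (e.injective (Subtype.ext hcd))
    · exact ⟨fun _ => hW.some, fun h => absurd h hoo⟩
  choose E hE using hE
  have hη : ∀ v w, ∃ η : ℤˣ, pairAt F' w = pairAt F v →
      ∀ s, F' (some (w, η * s)) = F (some (v, s)) := by
    intro v w
    by_cases hvw : pairAt F' w = pairAt F v
    · obtain ⟨η, hη⟩ := exists_units_of_pairAt_eq hvw
      exact ⟨η, fun _ => hη⟩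
    · exact ⟨1, fun h => absurd h hvw⟩
  choose η hη using hη
  have hΦ : ∃ Φ : V → W, ∀ c, Φ c = E (up c) (twist Φ (fun v => η v (Φ v)) (up c)) c := by
    have key : ∀ (Φ : V → W) (c : V), (match up c with
        | none => E none none c
        | some (p, s) => E (some (p, s)) (some (Φ p, η p (Φ p) * s)) c) =
        E (up c) (twist Φ (fun v => η v (Φ v)) (up c)) c := by
      intro Φ c
      split <;> rename_i hc <;> rw [hc] <;> rfl
    refine ⟨hup.wf.fix fun c rec => match hc : up c with
      | none => E none none c
      | some (p, s) => E (some (p, s)) (some (rec p ⟨s, hc⟩, η p (rec p ⟨s, hc⟩) * s)) c,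
      fun c => ?_⟩
    rw [← key, WellFounded.fix_eq]
    split <;> rename_i hc
    · split <;> simp_all
    · split
      · simp_all
      · rename_i h'
        rw [hc] at h'
        cases h'
        rfl
  obtain ⟨Φ, hΦ⟩ := hΦ
  have hp : ∀ c, F' (twist Φ (fun v => η v (Φ v)) (up c)) = F (up c) ∧
      pairAt F' (Φ c) = pairAt F c := by
    intro c
    induction c using hup.wf.induction with
    | _ c ih =>
      have h1 : F' (twist Φ (fun v => η v (Φ v)) (up c)) = F (up c) := by
        rcases hc : up c with _ | ⟨p, s⟩
        · exact h
        · exact hη p (Φ p) (ih p ⟨s, hc⟩).2 s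
      refine ⟨h1, ?_⟩
      rw [hΦ c]
      exact (((hE _ _ h1).1 c rfl).2)
  have hup' : ∀ c, up' (Φ c) = twist Φ (fun v => η v (Φ v)) (up c) := by
    intro c
    conv_lhs => rw [hΦ c]
    exact ((hE _ _ (hp c).1).1 c rfl).1
  -- Equal images have equal twisted parents, hence by induction equal parents with equal signs, and
  -- `E` is injective on siblings. Surjectivity then follows from the cardinalities.
  have hinj : Function.Injective Φ := by
    intro c
    induction c using hup.wf.induction with
    | _ c ih =>
      intro d hcd
      have hud : up c = up d := by
        have h1 := hup' c
        rw [hcd, hup' d] at h1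
        rcases hc : up c with _ | ⟨p, s⟩ <;> rcases hd : up d with _ | ⟨q, t⟩ <;>
          rw [hc, hd] at h1
        · simp at h1
        · simp at h1
        · rw [twist_some, twist_some, Option.some.injEq, Prod.mk.injEq] at h1
          obtain rfl := ih p ⟨s, hc⟩ h1.1.symm
          simpa using h1.2.symm
      refine (hE _ _ (hp c).1).2 c d rfl hud.symm ?_
      rw [← hΦ c, hcd, hΦ d, hud]
  exact ⟨Equiv.ofBijective _ ((Fintype.bijective_iff_injective_and_card _).2 ⟨hinj, hcard⟩), _,
    hup'⟩

/-- Double counting: the sum of `size (F o)` over all `o` equals the sum over the vertices `c` of 1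
plus the sizes at `(c, 1)` and `(c, -1)`. Everything cancels except `size (F none)` and the number
of vertices. -/
theorem IsShape.size_none (hF : IsShape up F) : size (F none) = Fintype.card V := by
  classical
  have h : ∀ o, size (F o) = ∑ c : V with up c = o, pairSize (pairAt F c) := by
    intro o
    conv_lhs => rw [hF o, size_ofMultiset, Multiset.map_map]
    rw [children, Finset.sum]
    congr! 2
  have h1 : ∑ o, size (F o) = ∑ c, pairSize (pairAt F c) := by
    rw [← Finset.sum_fiberwise (s := Finset.univ) (g := up)]
    exact Finset.sum_congr rfl fun o _ => h o
  rw [Fintype.sum_option, Fintype.sum_prod_type] at h1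
  have h2 : ∀ c, pairSize (pairAt F c) = (∑ s : ℤˣ, size (F (some (c, s)))) + 1 := by
    intro c
    rw [pairAt, pairSize_mk]
    congr 1
  simp only [h2, Finset.sum_add_distrib] at h1
  simpa [add_comm] using h1

end Shape

end PairForest


/-! ### Every unlabelled forest comes from a signed forest -/

namespace PairForest

/-- Carry the parents of `V` to a larger set, where the roots of `V` get a new parent `o₀`. -/
def graft {V W : Type*} (f : V → W) (o₀ : Option (W × ℤˣ)) :
    Option (V × ℤˣ) → Option (W × ℤˣ)
  | none => o₀
  | some (v, s) => some (f v, s)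

/-- The parent function of the forest with one tree, that consists of two forests below a root,
and a third forest. -/
def consUp {L R T : Type*} (upL : L → Option (L × ℤˣ)) (upR : R → Option (R × ℤˣ))
    (upT : T → Option (T × ℤˣ)) : Option (L ⊕ R ⊕ T) → Option (Option (L ⊕ R ⊕ T) × ℤˣ)
  | none => none
  | some (.inl v) => graft (fun v => some (.inl v)) (some (none, 1)) (upL v)
  | some (.inr (.inl v)) => graft (fun v => some (.inr (.inl v))) (some (none, -1)) (upR v)
  | some (.inr (.inr v)) => graft (fun v => some (.inr (.inr v))) none (upT v)

theorem isParentFun_consUp {L R T : Type*} {upL : L → Option (L × ℤˣ)}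
    {upR : R → Option (R × ℤˣ)} {upT : T → Option (T × ℤˣ)} (hL : IsParentFun upL)
    (hR : IsParentFun upR) (hT : IsParentFun upT) : IsParentFun (consUp upL upR upT) := by
  obtain ⟨dL, hL⟩ := hL
  obtain ⟨dR, hR⟩ := hR
  obtain ⟨dT, hT⟩ := hT
  refine ⟨fun w => match w with
    | none => 0
    | some (.inl v) => dL v + 1
    | some (.inr (.inl v)) => dR v + 1
    | some (.inr (.inr v)) => dT v + 1, ?_⟩
  rintro (_ | v | v | v) p s h
  · simp [consUp] at h
  · rcases hv : upL v with _ | ⟨q, t⟩ <;> simp only [consUp, hv, graft] at h <;> cases h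
    · simp
    · simpa using hL _ _ _ hv
  · rcases hv : upR v with _ | ⟨q, t⟩ <;> simp only [consUp, hv, graft] at h <;> cases h
    · simp
    · simpa using hR _ _ _ hv
  · rcases hv : upT v with _ | ⟨q, t⟩ <;> simp only [consUp, hv, graft] at h <;> cases h
    simpa using hT _ _ _ hv

/-- Induction on `q`: for `cons l r t`, realisations of `l`, `r`, `t` are placed side by side, and a
new root `none` is joined to the roots of the first by edges of sign `1` and to those of the second
by edges of sign `-1`. -/
theorem exists_shape_eq (q : PairForest) : ∃ (V : Type) (_ : Fintype V)
    (up : V → Option (V × ℤˣ)) (F : Option (V × ℤˣ) → PairForest),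
      IsParentFun up ∧ IsShape up F ∧ F none = q := by
  induction q using PairForest.induction with
  | h0 =>
    have hup : IsParentFun fun v : Empty => (none : Option (Empty × ℤˣ)) :=
      ⟨fun _ => 0, fun c => c.elim⟩
    obtain ⟨F, hF⟩ := exists_isShape hup
    refine ⟨Empty, inferInstance, _, F, hup, hF, ?_⟩
    rw [hF, Finset.eq_empty_of_isEmpty (children _ _)]
    rfl
  | h l r t hl hr ht =>
    obtain ⟨L, _, upL, FL, hupL, hFL, rfl⟩ := hl
    obtain ⟨R, _, upR, FR, hupR, hFR, rfl⟩ := hr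
    obtain ⟨T, _, upT, FT, hupT, hFT, rfl⟩ := ht
    have hup := isParentFun_consUp hupL hupR hupT
    obtain ⟨F, hF⟩ := exists_isShape hup
    refine ⟨_, inferInstance, _, F, hup, hF, ?_⟩
    obtain ⟨iL, hiL⟩ : ∃ iL : L ↪ Option (L ⊕ R ⊕ T), ∀ v, iL v = some (.inl v) :=
      ⟨⟨fun v => some (.inl v), fun _ _ h => by simpa using h⟩, fun _ => rfl⟩
    obtain ⟨iR, hiR⟩ : ∃ iR : R ↪ Option (L ⊕ R ⊕ T), ∀ v, iR v = some (.inr (.inl v)) :=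
      ⟨⟨fun v => some (.inr (.inl v)), fun _ _ h => by simpa using h⟩, fun _ => rfl⟩
    obtain ⟨iT, hiT⟩ : ∃ iT : T ↪ Option (L ⊕ R ⊕ T), ∀ v, iT v = some (.inr (.inr v)) :=
      ⟨⟨fun v => some (.inr (.inr v)), fun _ _ h => by simpa using h⟩, fun _ => rfl⟩
    have cL : ∀ p s, children (consUp upL upR upT) (some (iL p, s)) =
        (children upL (some (p, s))).map iL := by
      intro p s
      ext w
      rcases w with _ | v | v | v
      · simp [consUp, hiL]
      · rcases hv : upL v with _ | ⟨q, t⟩ <;> simp [consUp, hv, graft, hiL]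
      · rcases hv : upR v with _ | ⟨q, t⟩ <;> simp [consUp, hv, graft, hiL]
      · rcases hv : upT v with _ | ⟨q, t⟩ <;> simp [consUp, hv, graft, hiL]
    have cR : ∀ p s, children (consUp upL upR upT) (some (iR p, s)) =
        (children upR (some (p, s))).map iR := by
      intro p s
      ext w
      rcases w with _ | v | v | v
      · simp [consUp, hiR]
      · rcases hv : upL v with _ | ⟨q, t⟩ <;> simp [consUp, hv, graft, hiR]
      · rcases hv : upR v with _ | ⟨q, t⟩ <;> simp [consUp, hv, graft, hiR]
      · rcases hv : upT v with _ | ⟨q, t⟩ <;> simp [consUp, hv, graft, hiR]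
    have cT : ∀ p s, children (consUp upL upR upT) (some (iT p, s)) =
        (children upT (some (p, s))).map iT := by
      intro p s
      ext w
      rcases w with _ | v | v | v
      · simp [consUp, hiT]
      · rcases hv : upL v with _ | ⟨q, t⟩ <;> simp [consUp, hv, graft, hiT]
      · rcases hv : upR v with _ | ⟨q, t⟩ <;> simp [consUp, hv, graft, hiT]
      · rcases hv : upT v with _ | ⟨q, t⟩ <;> simp [consUp, hv, graft, hiT]
    have c1 : children (consUp upL upR upT) (some (none, 1)) =
        (children upL none).map iL := by
      ext w
      rcases w with _ | v | v | v
      · simp [consUp, hiL]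
      · rcases hv : upL v with _ | ⟨q, t⟩ <;> simp [consUp, hv, graft, hiL]
      · rcases hv : upR v with _ | ⟨q, t⟩ <;> simp [consUp, hv, graft, hiL]
      · rcases hv : upT v with _ | ⟨q, t⟩ <;> simp [consUp, hv, graft, hiL]
    have c2 : children (consUp upL upR upT) (some (none, -1)) =
        (children upR none).map iR := by
      ext w
      rcases w with _ | v | v | v
      · simp [consUp, hiR]
      · rcases hv : upL v with _ | ⟨q, t⟩ <;> simp [consUp, hv, graft, hiR]
      · rcases hv : upR v with _ | ⟨q, t⟩ <;> simp [consUp, hv, graft, hiR]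
      · rcases hv : upT v with _ | ⟨q, t⟩ <;> simp [consUp, hv, graft, hiR]
    have c3 : children (consUp upL upR upT) none =
        Finset.cons none ((children upT none).map iT) (by simp [hiT]) := by
      ext w
      rcases w with _ | v | v | v
      · simp [consUp]
      · rcases hv : upL v with _ | ⟨q, t⟩ <;> simp [consUp, hv, graft, hiT]
      · rcases hv : upR v with _ | ⟨q, t⟩ <;> simp [consUp, hv, graft, hiT]
      · rcases hv : upT v with _ | ⟨q, t⟩ <;> simp [consUp, hv, graft, hiT]
    -- Each part is closed under taking children and keeps its signs, so `eq_of_embedding` applies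
    -- with trivial `ε`.
    have pL : ∀ c, pairAt F (iL c) = pairAt FL c := fun c =>
      pairAt_eq_of_units 1 (hFL.eq_of_embedding hupL hF iL (fun _ => 1)
        (fun p s => by rw [one_mul]; exact cL p s) c)
    have pR : ∀ c, pairAt F (iR c) = pairAt FR c := fun c =>
      pairAt_eq_of_units 1 (hFR.eq_of_embedding hupR hF iR (fun _ => 1)
        (fun p s => by rw [one_mul]; exact cR p s) c)
    have pT : ∀ c, pairAt F (iT c) = pairAt FT c := fun c =>
      pairAt_eq_of_units 1 (hFT.eq_of_embedding hupT hF iT (fun _ => 1)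
        (fun p s => by rw [one_mul]; exact cT p s) c)
    rw [hF none, c3, Finset.cons_val, Multiset.map_cons, ofMultiset_cons, Finset.map_val,
      Multiset.map_map, show pairAt F ∘ iT = pairAt FT from funext pT, ← hFT none, pairAt,
      hFL.eq_of_children_map hF iL c1 fun c _ => pL c,
      hFR.eq_of_children_map hF iR c2 fun c _ => pR c, consPair_mk]

end PairForest

namespace SignedRootedForest

variable {n : ℕ}

/-- The unlabelled forest of a signed rooted forest. -/
noncomputable def shape (T : SignedRootedForest n) : PairForest :=
  (PairForest.exists_isShape T.isParentFun).choose none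

theorem size_shape (T : SignedRootedForest n) : T.shape.size = n :=
  (PairForest.exists_isShape T.isParentFun).choose_spec.size_none.trans (Fintype.card_fin n)

theorem twisted_iff_shape_eq (T T' : SignedRootedForest n) : T.Twisted T' ↔ T.shape = T'.shape := by
  have hF := (PairForest.exists_isShape T.isParentFun).choose_spec
  have hF' := (PairForest.exists_isShape T'.isParentFun).choose_spec
  exact ⟨fun ⟨π, ε, h⟩ => (hF.eq_of_twist T.isParentFun hF' π ε h).symm,
    fun h => hF.exists_twist T.isParentFun hF' rfl h.symm⟩

theorem exists_shape_eq (q : PairForest) : ∃ T : SignedRootedForest q.size, T.shape = q := by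
  obtain ⟨V, _, up, F, hup, hF, rfl⟩ := q.exists_shape_eq
  have e : V ≃ Fin (F none).size := Fintype.equivFinOfCardEq hF.size_none.symm
  have hup' : IsParentFun fun i => twist e (fun _ => 1) (up (e.symm i)) := by
    obtain ⟨d, hd⟩ := hup
    refine ⟨fun i => d (e.symm i), fun c p s h => ?_⟩
    dsimp only at h ⊢
    rcases hc : up (e.symm c) with _ | ⟨q, t⟩ <;> rw [hc] at h
    · simp at h
    · rw [twist_some, Option.some.injEq, Prod.mk.injEq] at h
      rw [← h.1, e.symm_apply_apply]
      exact hd _ _ _ hc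
  let T : SignedRootedForest (F none).size := ⟨_, hup'.wf⟩
  refine ⟨T, hF.eq_of_twist hup (PairForest.exists_isShape T.isParentFun).choose_spec e
    (fun _ => 1) fun c => ?_⟩
  simp [T]

instance : Finite (SignedRootedForest n) :=
  Finite.of_injective SignedRootedForest.up fun _ _ h => SignedRootedForest.ext h

/-- The unlabelled forest of a signed rooted forest, as a forest with `n` vertices. -/
noncomputable def sizedShape (T : SignedRootedForest n) : {q : PairForest // q.size = n} :=
  ⟨T.shape, T.size_shape⟩

theorem sizedShape_surjective : Function.Surjective (sizedShape (n := n)) := by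
  rintro ⟨q, rfl⟩
  obtain ⟨T, hT⟩ := exists_shape_eq q
  exact ⟨T, Subtype.ext hT⟩

end SignedRootedForest

theorem forestClassCount_eq_card_pairForest (n : ℕ) :
    forestClassCount n = Nat.card {q : PairForest // q.size = n} :=
  SignedRootedForest.forestClassCount_eq_card SignedRootedForest.sizedShape
    (fun T T' => by rw [T.twisted_iff_shape_eq, SignedRootedForest.sizedShape,
      SignedRootedForest.sizedShape, Subtype.mk.injEq])
    SignedRootedForest.sizedShape_surjective

instance PairForest.finite_size (n : ℕ) : Finite {q : PairForest // q.size = n} :=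
  Finite.of_surjective _ SignedRootedForest.sizedShape_surjective


/-! ### Counting multisets of given weight -/

section MultisetCount

open Finset

variable {A : Type*}

/-- Multisets that contain `a` at least `k` times correspond to all multisets of smaller weight. -/
theorem card_multiset_le_count [DecidableEq A] {w : A → ℕ} {S : ℕ → Finset (Multiset A)}
    (hS : ∀ n M, M ∈ S n ↔ (M.map w).sum = n) (n k : ℕ) (a : A) :
    ((S n).filter fun M => k ≤ M.count a).card =
      if k * w a ≤ n then (S (n - k * w a)).card else 0 := by
  have hw : ∀ M : Multiset A, ((M + Multiset.replicate k a).map w).sum =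
      (M.map w).sum + k * w a := by
    intro M
    simp
  have hsub : ∀ M : Multiset A, k ≤ M.count a →
      M - Multiset.replicate k a + Multiset.replicate k a = M := fun M hM =>
    tsub_add_cancel_of_le (Multiset.le_count_iff_replicate_le.1 hM)
  split_ifs with h
  · refine card_nbij' (fun M => M - Multiset.replicate k a) (fun M => M + Multiset.replicate k a)
      ?_ ?_ ?_ ?_
    · intro M hM
      obtain ⟨hM, hk⟩ := mem_filter.1 hM
      have h1 := hw (M - Multiset.replicate k a)
      rw [hsub M hk, (hS _ _).1 hM] at h1
      exact (hS _ _).2 (Nat.eq_sub_of_add_eq h1.symm)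
    · intro M hM
      have h1 := (hS _ _).1 hM
      refine mem_filter.2 ⟨(hS _ _).2 ?_, ?_⟩
      · rw [hw, h1]
        omega
      · simp
    · intro M hM
      exact hsub M (mem_filter.1 hM).2
    · intro M _
      simp
  · refine card_eq_zero.2 (filter_eq_empty_iff.2 fun M hM hk => h ?_)
    have h1 := hw (M - Multiset.replicate k a)
    rw [hsub M hk, (hS _ _).1 hM] at h1
    omega

/-- The substitution `j = k * d` turns a sum over multiplicities `k` into a sum over multiples of
`d`; divisor sums arise from it below. -/
theorem sum_multiples {n d : ℕ} (hd : 0 < d) (f : ℕ → ℕ) :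
    (∑ k ∈ Icc 1 n, if k * d ≤ n then f (k * d) else 0) =
      ∑ j ∈ Icc 1 n, if d ∣ j then f j else 0 := by
  rw [← sum_filter, ← sum_filter]
  refine sum_nbij' (fun k => k * d) (fun j => j / d) ?_ ?_ ?_ ?_ fun _ _ => rfl
  · intro k hk
    simp only [mem_filter, mem_Icc] at hk ⊢
    exact ⟨⟨Nat.mul_pos hk.1.1 hd, hk.2⟩, dvd_mul_left d k⟩
  · intro j hj
    simp only [mem_filter, mem_Icc] at hj ⊢
    obtain ⟨⟨h1, h2⟩, c, rfl⟩ := hj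
    rw [Nat.mul_div_cancel_left c hd, mul_comm c d]
    exact ⟨⟨Nat.pos_of_mul_pos_left h1, (Nat.le_mul_of_pos_left c hd).trans h2⟩, h2⟩
  · intro k _
    exact Nat.mul_div_cancel k hd
  · intro j hj
    exact Nat.div_mul_cancel (mem_filter.1 hj).2

/-- The recursion for the numbers of multisets of given weight. -/
theorem mul_card_multiset {w : A → ℕ} (hw : ∀ a, 0 < w a) {B : ℕ → Finset A}
    (hB : ∀ n a, a ∈ B n ↔ w a = n) {S : ℕ → Finset (Multiset A)}
    (hS : ∀ n M, M ∈ S n ↔ (M.map w).sum = n) (n : ℕ) :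
    n * (S n).card = ∑ j ∈ Icc 1 n, (∑ d ∈ j.divisors, d * (B d).card) * (S (n - j)).card := by
  classical
  have hle : ∀ M ∈ S n, ∀ a ∈ M, w a ≤ n := by
    intro M hM a ha
    rw [← (hS n M).1 hM]
    exact Multiset.single_le_sum (fun _ _ => Nat.zero_le _) _ (Multiset.mem_map_of_mem w ha)
  -- `M` itself lies in the set counted by `card_multiset_le_count` with `k = M.count a`, so `k * w
  -- a ≤ n`.
  have hcount : ∀ M ∈ S n, ∀ a, M.count a ≤ n := by
    intro M hM a
    have h1 := (card_multiset_le_count hS n (M.count a) a)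
    have h2 : 0 < ((S n).filter fun M' => M.count a ≤ M'.count a).card :=
      card_pos.2 ⟨M, mem_filter.2 ⟨hM, le_rfl⟩⟩
    rw [h1] at h2
    split_ifs at h2 with h
    · exact (Nat.le_mul_of_pos_right _ (hw a)).trans h
    · exact absurd h2 (lt_irrefl 0)
  -- The weight `n` of `M` is the sum of `M.count a * w a`. The elements are grouped by weight `d`,
  -- and the multiplicity is written as the number of `k ≥ 1` with `k ≤ M.count a`.
  have hsum : ∀ M ∈ S n, n = ∑ d ∈ Icc 1 n, ∑ a ∈ B d, ∑ k ∈ Icc 1 n,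
      if k ≤ M.count a then d else 0 := by
    intro M hM
    have h1 : ∀ d, ∀ a ∈ B d, (∑ k ∈ Icc 1 n, if k ≤ M.count a then d else 0) =
        M.count a * w a := by
      intro d a ha
      rw [← sum_filter, sum_const, smul_eq_mul, (hB d a).1 ha]
      congr 1
      have : (Icc 1 n).filter (fun k => k ≤ M.count a) = Icc 1 (M.count a) := by
        ext k
        have := hcount M hM a
        simp only [mem_filter, mem_Icc]
        omega
      rw [this, Nat.card_Icc, Nat.add_sub_cancel]
    rw [sum_congr rfl fun d _ => sum_congr rfl (h1 d)]
    rw [← sum_biUnion fun d _ d' _ hdd' => disjoint_left.2 fun a ha ha' => hdd'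
      (((hB d a).1 ha).symm.trans ((hB d' a).1 ha'))]
    conv_lhs => rw [← (hS n M).1 hM, sum_multiset_map_count]
    simp only [smul_eq_mul]
    refine sum_subset ?_ ?_
    · intro a ha
      have ha' := Multiset.mem_toFinset.1 ha
      exact mem_biUnion.2 ⟨w a, mem_Icc.2 ⟨hw a, hle M hM a ha'⟩, (hB _ _).2 rfl⟩
    · intro a _ ha
      rw [Multiset.count_eq_zero_of_notMem (fun h => ha (Multiset.mem_toFinset.2 h)), zero_mul]
  -- After the sums are exchanged, a fixed `a` of weight `d` and a fixed `k` contribute `d` for each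
  -- multiset with at least `k` copies of `a`; there are as many as multisets of weight `n - k * d`.
  calc n * (S n).card = ∑ M ∈ S n, n := by rw [sum_const, smul_eq_mul, mul_comm]
    _ = ∑ M ∈ S n, ∑ d ∈ Icc 1 n, ∑ a ∈ B d, ∑ k ∈ Icc 1 n,
        (if k ≤ M.count a then d else 0) := sum_congr rfl hsum
    _ = ∑ d ∈ Icc 1 n, ∑ a ∈ B d, ∑ k ∈ Icc 1 n,
        ((S n).filter fun M => k ≤ M.count a).card * d := by
      rw [sum_comm]
      refine sum_congr rfl fun d _ => ?_
      rw [sum_comm]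
      refine sum_congr rfl fun a _ => ?_
      rw [sum_comm]
      refine sum_congr rfl fun k _ => ?_
      rw [← sum_filter, sum_const, smul_eq_mul]
    _ = ∑ d ∈ Icc 1 n, ∑ a ∈ B d, d * ∑ j ∈ Icc 1 n,
        if d ∣ j then (S (n - j)).card else 0 := by
      refine sum_congr rfl fun d hd => sum_congr rfl fun a ha => ?_
      rw [← sum_multiples (mem_Icc.1 hd).1 fun j => (S (n - j)).card, mul_sum]
      refine sum_congr rfl fun k _ => ?_
      rw [card_multiset_le_count hS, (hB d a).1 ha, mul_comm]
    _ = ∑ j ∈ Icc 1 n, ∑ d ∈ Icc 1 n, if d ∣ j then d * (B d).card * (S (n - j)).card else 0 := by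
      rw [sum_comm]
      refine sum_congr rfl fun d _ => ?_
      rw [sum_const, smul_eq_mul, mul_sum, mul_sum]
      refine sum_congr rfl fun j _ => ?_
      split_ifs <;> ring
    _ = _ := by
      refine sum_congr rfl fun j hj => ?_
      rw [← sum_filter, sum_mul]
      refine sum_congr ?_ fun _ _ => rfl
      ext d
      have hj' := mem_Icc.1 hj
      simp only [mem_filter, mem_Icc, Nat.mem_divisors]
      constructor
      · rintro ⟨_, h⟩
        exact ⟨h, by omega⟩
      · rintro ⟨h, _⟩
        have h1 := Nat.le_of_dvd hj'.1 h
        have h2 := Nat.pos_of_dvd_of_pos h hj'.1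
        exact ⟨⟨h2, by omega⟩, h⟩

end MultisetCount

/-! ### Counting trees and forests -/

namespace PairForest

open Finset

theorem exists_finset_size :
    ∃ Q : ℕ → Finset PairForest, ∀ n q, q ∈ Q n ↔ q.size = n := by
  have h : ∀ n, ∃ Q : Finset PairForest, ∀ q, q ∈ Q ↔ q.size = n := fun n =>
    ⟨(@Finset.univ _ (Fintype.ofFinite {q : PairForest // q.size = n})).map
      (Function.Embedding.subtype _), fun q => by simp⟩
  choose Q hQ using h
  exact ⟨Q, hQ⟩

theorem card_eq_forestClassCount {Q : ℕ → Finset PairForest} (hQ : ∀ n q, q ∈ Q n ↔ q.size = n)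
    (n : ℕ) : (Q n).card = forestClassCount n := by
  rw [forestClassCount_eq_card_pairForest, Nat.subtype_card (Q n) (hQ n)]

/-- Burnside's count for the swap: ordered pairs plus diagonal pairs are twice the unordered pairs.
A diagonal pair has even total size, whence the term at `m / 2`. -/
theorem exists_finset_pairSize {Q : ℕ → Finset PairForest} (hQ : ∀ n q, q ∈ Q n ↔ q.size = n) :
    ∃ B : ℕ → Finset (Sym2 PairForest), (∀ n p, p ∈ B n ↔ pairSize p = n) ∧
      ∀ n, ((B n).card : ℚ) = treeCoeff (fun m => ((Q m).card : ℚ)) n := by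
  classical
  let P : ℕ → Finset (PairForest × PairForest) := fun m =>
    (antidiagonal m).biUnion fun e => Q e.1 ×ˢ Q e.2
  have hP : ∀ m p, p ∈ P m ↔ p.1.size + p.2.size = m := by
    intro m p
    simp [P, hQ]
  have hPcard : ∀ m, (P m).card = ∑ e ∈ antidiagonal m, (Q e.1).card * (Q e.2).card := by
    intro m
    simp only [P]
    rw [card_biUnion]
    · simp only [card_product]
    · intro e _ e' _ hee'
      refine disjoint_left.2 fun p hp hp' => hee' ?_
      simp only [mem_product, hQ] at hp hp'
      exact Prod.ext (hp.1.symm.trans hp'.1) (hp.2.symm.trans hp'.2)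
  let D : ℕ → Finset (PairForest × PairForest) := fun m => (P m).filter fun p => p.1 = p.2
  have hDcard : ∀ m, (D m).card = if 2 ∣ m then (Q (m / 2)).card else 0 := by
    intro m
    split_ifs with h
    · obtain ⟨k, rfl⟩ := h
      rw [Nat.mul_div_cancel_left k two_pos]
      refine card_nbij' (fun p => p.1) (fun q => (q, q)) ?_ ?_ ?_ ?_
      · rintro ⟨p, q⟩ hp
        simp only [D, coe_filter, Set.mem_ofPred_eq, hP] at hp
        obtain ⟨h1, rfl⟩ := hp
        exact (hQ _ _).2 (by dsimp only at h1 ⊢; omega)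
      · intro q hq
        have := (hQ _ _).1 hq
        simp only [D, coe_filter, Set.mem_ofPred_eq, hP]
        exact ⟨by omega, trivial⟩
      · rintro ⟨p, q⟩ hp
        simp only [D, coe_filter, Set.mem_ofPred_eq] at hp
        exact Prod.ext rfl hp.2
      · intro q _
        rfl
    · refine card_eq_zero.2 (filter_eq_empty_iff.2 fun p hp hpp => h ?_)
      have := (hP _ _).1 hp
      rw [hpp] at this
      exact ⟨p.2.size, by omega⟩
  let B : ℕ → Finset (Sym2 PairForest) := fun m =>
    if m = 0 then ∅ else (P (m - 1)).image fun p => s(p.1, p.2)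
  -- Over `s(l, r)` there are two ordered and no diagonal pairs if `l ≠ r`, and one of each if `l =
  -- r`: always two in total.
  have hBcard : ∀ m, (P m).card + (D m).card = 2 * (B (m + 1)).card := by
    intro m
    have h1 : (P m).card = ∑ a ∈ B (m + 1), ((P m).filter fun p => s(p.1, p.2) = a).card :=
      card_eq_sum_card_fiberwise fun p hp => mem_image_of_mem _ hp
    have h2 : (D m).card = ∑ a ∈ B (m + 1), ((D m).filter fun p => s(p.1, p.2) = a).card :=
      card_eq_sum_card_fiberwise fun p hp => mem_image_of_mem _ (filter_subset _ _ hp)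
    rw [h1, h2, ← sum_add_distrib, mul_comm, ← smul_eq_mul, ← sum_const]
    refine sum_congr rfl fun a ha => ?_
    obtain ⟨⟨l, r⟩, hlr, rfl⟩ := mem_image.1 ha
    have hlr : l.size + r.size = m := (hP _ _).1 hlr
    by_cases h : l = r
    · subst h
      have h3 : ((P m).filter fun p => s(p.1, p.2) = s(l, l)) = {(l, l)} := by
        ext ⟨x, y⟩
        simp only [mem_filter, hP, mem_singleton, Sym2.eq_iff, Prod.mk.injEq, or_self]
        constructor
        · exact fun h => h.2
        · rintro ⟨rfl, rfl⟩
          exact ⟨hlr, rfl, rfl⟩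
      have h4 : ((D m).filter fun p => s(p.1, p.2) = s(l, l)) = {(l, l)} := by
        rw [filter_filter, filter_congr (q := fun p => s(p.1, p.2) = s(l, l)), h3]
        rintro ⟨x, y⟩ _
        simp only [Sym2.eq_iff, or_self, and_iff_right_iff_imp]
        rintro ⟨rfl, rfl⟩
        rfl
      rw [h3, h4]
      rfl
    · have h3 : ((P m).filter fun p => s(p.1, p.2) = s(l, r)) = {(l, r), (r, l)} := by
        ext ⟨x, y⟩
        simp only [mem_filter, hP, mem_insert, mem_singleton, Sym2.eq_iff, Prod.mk.injEq]
        constructor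
        · exact fun h => h.2
        · rintro (⟨rfl, rfl⟩ | ⟨rfl, rfl⟩)
          · exact ⟨hlr, Or.inl ⟨rfl, rfl⟩⟩
          · exact ⟨by omega, Or.inr ⟨rfl, rfl⟩⟩
      have h4 : ((D m).filter fun p => s(p.1, p.2) = s(l, r)) = ∅ := by
        refine filter_eq_empty_iff.2 ?_
        rintro ⟨x, y⟩ hxy he
        obtain rfl : x = y := (mem_filter.1 hxy).2
        rcases Sym2.eq_iff.1 he with ⟨rfl, rfl⟩ | ⟨rfl, rfl⟩ <;> exact h rfl
      rw [h3, h4, card_pair (fun h' => h (Prod.mk.inj h').1)]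
      rfl
  refine ⟨B, ?_, ?_⟩
  · intro n p
    induction p with
    | _ l r =>
      rcases n with _ | m
      · simp [B]
      · simp only [B, Nat.add_one_ne_zero, if_false, Nat.add_sub_cancel, mem_image, pairSize_mk,
          Nat.add_right_cancel_iff]
        constructor
        · rintro ⟨⟨x, y⟩, hxy, he⟩
          replace he : s(x, y) = s(l, r) := he
          replace hxy : x.size + y.size = m := (hP _ _).1 hxy
          rcases Sym2.eq_iff.1 he with ⟨rfl, rfl⟩ | ⟨rfl, rfl⟩ <;> omega
        · intro h
          exact ⟨(l, r), (hP _ _).2 h, rfl⟩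
  · rintro (_ | m)
    · simp [B, treeCoeff]
    · have h := hBcard m
      rw [hPcard, hDcard] at h
      have h' : (((∑ e ∈ antidiagonal m, (Q e.1).card * (Q e.2).card) +
          (if 2 ∣ m then (Q (m / 2)).card else 0) : ℕ) : ℚ) = ((2 * (B (m + 1)).card : ℕ) : ℚ) := by
        rw [h]
      push_cast at h'
      rw [treeCoeff]
      linarith

end PairForest

/-- `equivMultiset` carries the forests of size `n` to the multisets of trees of total weight `n`,
to which `mul_card_multiset` applies. -/
theorem forestRecursion_forestClassCount : ForestRecursion fun n => (forestClassCount n : ℚ) := by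
  obtain ⟨Q, hQ⟩ := PairForest.exists_finset_size
  obtain ⟨B, hB, hBQ⟩ := PairForest.exists_finset_pairSize hQ
  have hcard := PairForest.card_eq_forestClassCount hQ
  let S : ℕ → Finset (Multiset (Sym2 PairForest)) := fun n =>
    (Q n).map PairForest.equivMultiset.toEmbedding
  have hS : ∀ n M, M ∈ S n ↔ (M.map PairForest.pairSize).sum = n := by
    intro n M
    rw [← PairForest.size_ofMultiset, ← hQ]
    exact Finset.mem_map_equiv
  have hScard : ∀ n, (S n).card = forestClassCount n := fun n =>
    (Finset.card_map _).trans (hcard n)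
  have hpos : ∀ p, 0 < PairForest.pairSize p := by
    intro p
    induction p with
    | _ l r => simp
  refine ⟨?_, fun n => ?_⟩
  · have h0 : S 0 = {0} := by
      ext M
      rw [hS, Finset.mem_singleton]
      constructor
      · intro h
        refine Multiset.eq_zero_of_forall_notMem fun p hp => (hpos p).ne' ?_
        exact Multiset.sum_eq_zero_iff.1 h _ (Multiset.mem_map_of_mem _ hp)
      · rintro rfl
        rfl
    dsimp only
    rw [← hScard, h0]
    simp
  · have h := mul_card_multiset hpos hB hS (n + 1)
    simp only [hScard] at h
    have h' := congrArg (Nat.cast : ℕ → ℚ) h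
    push_cast at h'
    simp only [hBQ, hcard] at h'
    rw [h']
    refine Finset.sum_nbij' (fun j => (j - 1, n + 1 - j)) (fun p => p.1 + 1) ?_ ?_ ?_ ?_ ?_
    · intro j hj
      have := Finset.mem_Icc.1 hj
      exact Finset.HasAntidiagonal.mem_antidiagonal.2 (by omega)
    · intro p hp
      have := Finset.HasAntidiagonal.mem_antidiagonal.1 hp
      exact Finset.mem_Icc.2 (by omega)
    · intro j hj
      have := Finset.mem_Icc.1 hj
      dsimp only
      omega
    · intro p hp
      have := Finset.HasAntidiagonal.mem_antidiagonal.1 hp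
      exact Prod.ext (by simp) (by dsimp only; omega)
    · intro j hj
      have := Finset.mem_Icc.1 hj
      dsimp only
      rw [Nat.sub_add_cancel this.1]


/-! ### Layered graphs are triangular cacti -/

namespace SimpleGraph

variable {V : Type*} {G : SimpleGraph V} {r : V}

/-- A layering of a graph whose cycles are edge-disjoint triangles: the distance of each vertex
to a root `r`, the neighbour next to the root, and the neighbour in the same layer (which is the
vertex itself if there is no such neighbour). -/
structure TriangleLayering (G : SimpleGraph V) (r : V) where
  depth : V → ℕ
  par : V → V
  mate : V → V
  depth_root : depth r = 0
  adj_par : ∀ v, v ≠ r → G.Adj v (par v)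
  depth_par : ∀ v, v ≠ r → depth (par v) + 1 = depth v
  mate_mate : ∀ v, mate (mate v) = v
  depth_mate : ∀ v, depth (mate v) = depth v
  par_mate : ∀ v, v ≠ r → par (mate v) = par v
  adj_mate : ∀ v, mate v ≠ v → G.Adj v (mate v)
  adj_cases : ∀ v w, G.Adj v w → depth w ≤ depth v → w = par v ∨ w = mate v

namespace TriangleLayering

theorem eq_root (L : G.TriangleLayering r) {v : V} (h : L.depth v = 0) : v = r := by
  by_contra hv
  have := L.depth_par v hv
  omega

theorem mate_root (L : G.TriangleLayering r) : L.mate r = r :=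
  L.eq_root (by rw [L.depth_mate, L.depth_root])

theorem ne_root (L : G.TriangleLayering r) {v : V} (h : L.mate v ≠ v) : v ≠ r := by
  rintro rfl
  exact h L.mate_root

theorem mate_mate_ne (L : G.TriangleLayering r) {v : V} (h : L.mate v ≠ v) :
    L.mate (L.mate v) ≠ L.mate v := by
  rw [L.mate_mate]
  exact h.symm

theorem depth_le_of_adj (L : G.TriangleLayering r) {v w : V} (h : G.Adj v w) :
    L.depth w ≤ L.depth v + 1 := by
  by_contra! hlt
  have hw : w ≠ r := by
    rintro rfl
    rw [L.depth_root] at hlt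
    omega
  rcases L.adj_cases w v h.symm (by omega) with rfl | rfl
  · have := L.depth_par w hw
    omega
  · rw [L.depth_mate] at hlt
    omega

theorem exists_walk (L : G.TriangleLayering r) (v : V) :
    ∃ p : G.Walk v r, p.length = L.depth v := by
  induction h : L.depth v generalizing v with
  | zero =>
    obtain rfl := L.eq_root h
    exact ⟨.nil, rfl⟩
  | succ k ih =>
    have hv : v ≠ r := by
      rintro rfl
      rw [L.depth_root] at h
      omega
    have h' := L.depth_par v hv
    obtain ⟨p, hp⟩ := ih (L.par v) (by omega)
    exact ⟨.cons (L.adj_par v hv) p, by rw [Walk.length_cons, hp]⟩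

theorem connected (L : G.TriangleLayering r) : G.Connected := by
  have : Nonempty V := ⟨r⟩
  refine ⟨fun v w => ?_⟩
  obtain ⟨p, -⟩ := L.exists_walk v
  obtain ⟨q, -⟩ := L.exists_walk w
  exact ⟨p.append q.reverse⟩

/-- Depth changes by at most one along an edge, and following `par` reaches the root in `depth`
steps. Depth is therefore intrinsic to the rooted graph, which is why isomorphisms respect parents
and mates. -/
theorem dist_eq (L : G.TriangleLayering r) (v : V) : G.dist v r = L.depth v := by
  have key : ∀ {u w : V} (p : G.Walk u w), L.depth u ≤ L.depth w + p.length := by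
    intro u w p
    induction p with
    | nil => simp
    | cons h p ih =>
      have := L.depth_le_of_adj h.symm
      rw [Walk.length_cons]
      omega
  obtain ⟨p, hp⟩ := L.exists_walk v
  obtain ⟨q, hq⟩ := L.connected.exists_walk_length_eq_dist v r
  have h1 := key q
  have h2 := dist_le p
  rw [L.depth_root] at h1
  omega

section Iso

variable {V' : Type*} {G' : SimpleGraph V'} {r' : V'}

theorem depth_map (L : G.TriangleLayering r) (L' : G'.TriangleLayering r') (e : G ≃g G')
    (he : e r = r') (v : V) : L'.depth (e v) = L.depth v := by
  refine le_antisymm ?_ ?_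
  · obtain ⟨p, hp⟩ := L.exists_walk v
    have := dist_le (p.map e.toHom)
    rw [Walk.length_map, hp] at this
    rw [← L'.dist_eq, ← he]
    exact this
  · obtain ⟨p, hp⟩ := L'.exists_walk (e v)
    have := dist_le (p.map e.symm.toHom)
    rw [Walk.length_map, hp] at this
    rw [← L.dist_eq]
    simpa [← he] using this

theorem par_map (L : G.TriangleLayering r) (L' : G'.TriangleLayering r') (e : G ≃g G')
    (he : e r = r') {v : V} (hv : v ≠ r) : L'.par (e v) = e (L.par v) := by
  have h1 := L.depth_par v hv
  have h2 := L.depth_map L' e he v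
  have h3 := L.depth_map L' e he (L.par v)
  rcases L'.adj_cases (e v) (e (L.par v)) (e.map_adj_iff.2 (L.adj_par v hv)) (by omega) with h | h
  · exact h.symm
  · have h4 := L'.depth_mate (e v)
    rw [← h] at h4
    omega

theorem mate_map (L : G.TriangleLayering r) (L' : G'.TriangleLayering r') (e : G ≃g G')
    (he : e r = r') {v : V} (hv : L.mate v ≠ v) : L'.mate (e v) = e (L.mate v) := by
  have h1 := L.depth_mate v
  have h2 := L.depth_map L' e he v
  have h3 := L.depth_map L' e he (L.mate v)
  have hr : e v ≠ r' := fun h => L.ne_root hv (e.injective (h.trans he.symm))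
  rcases L'.adj_cases (e v) (e (L.mate v)) (e.map_adj_iff.2 (L.adj_mate v hv)) (by omega)
    with h | h
  · have h4 := L'.depth_par (e v) hr
    rw [← h] at h4
    omega
  · exact h.symm

end Iso

/-- The vertices of the triangle above a vertex. -/
def triangle (L : G.TriangleLayering r) (v : V) : Set V := {L.par v, v, L.mate v}

theorem mem_triangle (L : G.TriangleLayering r) {v x : V} :
    x ∈ L.triangle v ↔ x = L.par v ∨ x = v ∨ x = L.mate v := Iff.rfl

theorem eq_par_or_depth_eq (L : G.TriangleLayering r) {v x : V} (h : x ∈ L.triangle v) :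
    x = L.par v ∨ L.depth x = L.depth v := by
  rcases h with rfl | rfl | rfl
  · exact Or.inl rfl
  · exact Or.inr rfl
  · exact Or.inr (L.depth_mate v)

theorem triangle_mate (L : G.TriangleLayering r) {v : V} (hv : L.mate v ≠ v) :
    L.triangle (L.mate v) = L.triangle v := by
  ext x
  rw [mem_triangle, mem_triangle, L.par_mate v (L.ne_root hv), L.mate_mate]
  tauto

theorem eq_or_eq_mate_of_triangle_eq (L : G.TriangleLayering r) {v w : V} (hv : L.mate v ≠ v)
    (hw : L.mate w ≠ w) (h : L.triangle v = L.triangle w) : v = w ∨ v = L.mate w := by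
  have h1 : v ∈ L.triangle w := h ▸ Or.inr (Or.inl rfl)
  have h2 : w ∈ L.triangle v := h.symm ▸ Or.inr (Or.inl rfl)
  rcases h1 with h1 | h1
  · exfalso
    have h3 := L.depth_par w (L.ne_root hw)
    have h4 := L.depth_par v (L.ne_root hv)
    rw [← h1] at h3
    rcases L.eq_par_or_depth_eq h2 with h5 | h5
    · rw [← h5] at h4
      omega
    · omega
  · exact h1

/-- Distinct triangles share no upper vertex, so a common vertex is the lowest vertex of the deeper
triangle (for equal depths, of both). -/
theorem subsingleton_inter_triangle (L : G.TriangleLayering r) {v w : V} (hv : L.mate v ≠ v)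
    (hw : L.mate w ≠ w) (h : L.triangle v ≠ L.triangle w) :
    (L.triangle v ∩ L.triangle w).Subsingleton := by
  have h1 : v ≠ w := by rintro rfl; exact h rfl
  have h2 : v ≠ L.mate w := by rintro rfl; exact h (L.triangle_mate hw)
  have h3 : L.mate v ≠ w := by rintro rfl; exact h (L.triangle_mate hv).symm
  have h4 : L.mate v ≠ L.mate w := fun h' =>
    h1 (by rw [← L.mate_mate v, h', L.mate_mate])
  have hpv := L.depth_par v (L.ne_root hv)
  have hpw := L.depth_par w (L.ne_root hw)
  have hmv := L.depth_mate v
  have hmw := L.depth_mate w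
  have key : ∀ x ∈ L.triangle v ∩ L.triangle w,
      (x = L.par v ∧ L.depth w ≤ L.depth v) ∨ (x = L.par w ∧ L.depth v < L.depth w) := by
    rintro x ⟨hx, hx'⟩
    rcases hx with rfl | rfl | rfl
    · rcases hx' with h' | h' | h'
      · rw [h'] at hpv
        exact Or.inl ⟨rfl, by omega⟩
      · rw [h'] at hpv
        exact Or.inl ⟨rfl, by omega⟩
      · rw [h'] at hpv
        exact Or.inl ⟨rfl, by omega⟩
    · rcases hx' with h' | h' | h'
      · rw [← h'] at hpw
        exact Or.inr ⟨h', by omega⟩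
      · exact absurd h' h1
      · exact absurd h' h2
    · rcases hx' with h' | h' | h'
      · rw [← h'] at hpw
        exact Or.inr ⟨h', by omega⟩
      · exact absurd h' h3
      · exact absurd h' h4
  intro x hx y hy
  rcases key x hx with ⟨rfl, h5⟩ | ⟨rfl, h5⟩ <;> rcases key y hy with ⟨rfl, h6⟩ | ⟨rfl, h6⟩
  · rfl
  · omega
  · omega
  · rfl

theorem triangle_isClique (L : G.TriangleLayering r) [DecidableEq V] {v : V}
    (hv : L.mate v ≠ v) : G.IsNClique 3 {L.par v, v, L.mate v} := by
  have hr := L.ne_root hv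
  have hr' := L.ne_root (L.mate_mate_ne hv)
  have h1 := L.adj_par _ hr'
  rw [L.par_mate v hr] at h1
  exact is3Clique_triple_iff.2 ⟨(L.adj_par v hr).symm, h1.symm, L.adj_mate v hv⟩

/-- The other two vertices of a 3-clique are neighbours of its deepest vertex `v` and not deeper, so
they are `par v` and `mate v`. -/
theorem isNClique_iff (L : G.TriangleLayering r) {t : Finset V} :
    G.IsNClique 3 t ↔ ∃ v, L.mate v ≠ v ∧ (t : Set V) = L.triangle v := by
  classical
  constructor
  · intro ht
    have hne : t.Nonempty := Finset.card_pos.1 (by rw [ht.card_eq]; norm_num)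
    obtain ⟨v, hv, hmax⟩ := t.exists_max_image L.depth hne
    have hsub : ∀ x ∈ t, x ≠ v → x = L.par v ∨ x = L.mate v := fun x hx hxv =>
      L.adj_cases v x (ht.isClique hv hx hxv.symm) (hmax x hx)
    have hle : t ⊆ {L.par v, v, L.mate v} := by
      intro x hx
      by_cases hxv : x = v
      · simp [hxv]
      · rcases hsub x hx hxv with h | h <;> simp [h]
    have hcard : ({L.par v, v, L.mate v} : Finset V).card ≤ t.card := by
      rw [ht.card_eq]
      exact Finset.card_le_three
    have heq := Finset.eq_of_subset_of_card_le hle hcard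
    refine ⟨v, fun h => ?_, ?_⟩
    · have h1 := ht.card_eq
      rw [heq, h] at h1
      have h2 : ({L.par v, v, v} : Finset V).card ≤ 2 := by
        simpa using Finset.card_le_two (a := L.par v) (b := v)
      omega
    · rw [heq]
      simp [triangle]
  · rintro ⟨v, hv, ht⟩
    have h : t = {L.par v, v, L.mate v} := by
      apply Finset.coe_injective
      rw [ht]
      simp [triangle]
    rw [h]
    exact L.triangle_isClique hv

/-- From the deepest vertex `v` the cycle goes to `mate v`. The next vertex is `par v` or `v`; a
cycle does not turn back, so it is `par v`, the penultimate vertex. -/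
theorem length_eq_three (L : G.TriangleLayering r) {v : V} (p : G.Walk v v) (hp : p.IsCycle)
    (hmax : ∀ x ∈ p.support, L.depth x ≤ L.depth v) (hs : p.snd = L.mate v)
    (ht : p.penultimate = L.par v) : p.length = 3 := by
  have hl := hp.three_le_length
  have hmv : L.mate v ≠ v := by
    rw [← hs]
    exact (p.adj_snd hp.not_nil).ne.symm
  have h2 : G.Adj (L.mate v) (p.getVert 2) := by
    rw [← hs]
    exact p.adj_getVert_succ (i := 1) (by omega)
  have h3 : p.getVert 2 = L.par v := by
    have hd : L.depth (p.getVert 2) ≤ L.depth (L.mate v) := by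
      rw [L.depth_mate]
      exact hmax _ (p.getVert_mem_support 2)
    rcases L.adj_cases _ _ h2 hd with h | h
    · rw [h, L.par_mate v (L.ne_root hmv)]
    · exfalso
      rw [L.mate_mate] at h
      have := hp.getVert_sub_one_ne_getVert_add_one (i := 1) (by omega)
      rw [h] at this
      simp at this
  rw [← ht] at h3
  have := hp.getVert_injOn (by simp; omega) (by simp; omega) h3
  omega

theorem cycle_eq_triangle (L : G.TriangleLayering r) {u : V} (p : G.Walk u u) (hp : p.IsCycle) :
    p.length = 3 ∧ ∃ v, L.mate v ≠ v ∧ {x | x ∈ p.support} = L.triangle v := by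
  classical
  obtain ⟨v, hv, hmax⟩ := p.support.toFinset.exists_max_image L.depth
    ⟨u, by simp⟩
  rw [List.mem_toFinset] at hv
  have hmax : ∀ x ∈ p.support, L.depth x ≤ L.depth v := fun x hx =>
    hmax x (List.mem_toFinset.2 hx)
  have hq : (p.rotate v hv).IsCycle := hp.rotate hv
  have hsupp : ∀ x, x ∈ (p.rotate v hv).support ↔ x ∈ p.support := fun x =>
    p.mem_support_rotate_iff _ hv
  have hlen : (p.rotate v hv).length = p.length := p.length_rotate _ hv
  -- The two neighbours of `v` on the rotated cycle are distinct, so they are `par v` and `mate v`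
  -- in some order; reversing the cycle fixes the order.
  suffices H : ∀ q : G.Walk v v, q.IsCycle → (∀ x, x ∈ q.support ↔ x ∈ p.support) →
      q.snd = L.mate v → q.penultimate = L.par v →
      q.length = 3 ∧ ∃ v, L.mate v ≠ v ∧ {x | x ∈ p.support} = L.triangle v by
    have hs := L.adj_cases v _ ((p.rotate v hv).adj_snd hq.not_nil)
      (hmax _ ((hsupp _).1 (Walk.getVert_mem_support _ _)))
    have ht := L.adj_cases v _ ((p.rotate v hv).adj_penultimate hq.not_nil).symm
      (hmax _ ((hsupp _).1 (Walk.getVert_mem_support _ _)))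
    have hne := hq.snd_ne_penultimate
    rw [← hlen]
    rcases hs with hs | hs <;> rcases ht with ht | ht
    · exact absurd (hs.trans ht.symm) hne
    · rw [← Walk.length_reverse]
      refine H _ hq.reverse (fun x => ?_) ?_ ?_
      · rw [Walk.support_reverse, List.mem_reverse, hsupp]
      · rw [Walk.snd_reverse, ht]
      · rw [Walk.penultimate_reverse, hs]
    · exact H _ hq hsupp hs ht
    · exact absurd (hs.trans ht.symm) hne
  intro q hq hsupp hs ht
  have hl := L.length_eq_three q hq (fun x hx => hmax x ((hsupp x).1 hx)) hs ht
  refine ⟨hl, v, ?_, ?_⟩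
  · rw [← hs]
    exact (q.adj_snd hq.not_nil).ne.symm
  · ext x
    rw [mem_triangle, ← ht, ← hs]
    refine Iff.trans (hsupp x).symm ?_
    rw [Walk.mem_support_iff_exists_getVert]
    constructor
    · rintro ⟨i, rfl, hi⟩
      rw [hl] at hi
      interval_cases i
      · simp
      · exact Or.inr (Or.inr rfl)
      · left
        rw [Walk.penultimate, hl]
      · right
        left
        rw [← hl, Walk.getVert_length]
    · rintro (rfl | rfl | rfl)
      · exact ⟨q.length - 1, rfl, Nat.sub_le _ _⟩
      · exact ⟨0, q.getVert_zero, Nat.zero_le _⟩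
      · exact ⟨1, rfl, by omega⟩

end TriangleLayering

/-- The support of a closed walk of length three determines its subgraph, so two different cycles
have different triangles. -/
theorem Walk.toSubgraph_adj_of_length_three {u : V} (p : G.Walk u u) (hp : p.length = 3) {x y : V} :
    p.toSubgraph.Adj x y ↔ x ≠ y ∧ x ∈ p.support ∧ y ∈ p.support := by
  rw [Walk.adj_toSubgraph_iff_mem_edges]
  match p, hp with
  | .cons (v := a) h₁ (.cons (v := b) h₂ (.cons h₃ .nil)), _ =>
    have n1 := h₁.ne
    have n2 := h₂.ne
    have n3 := h₃.ne
    simp only [Walk.edges_cons, Walk.edges_nil, Walk.support_cons, Walk.support_nil,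
      List.mem_cons, List.not_mem_nil, Sym2.eq_iff, or_false]
    grind

theorem TriangleLayering.isTriangularCactus (L : G.TriangleLayering r) :
    G.IsTriangularCactus := by
  refine ⟨L.connected, ?_, fun u p hp => (L.cycle_eq_triangle p hp).1⟩
  intro u u' p q hp hq hpq
  obtain ⟨hpl, v, hv, hpv⟩ := L.cycle_eq_triangle p hp
  obtain ⟨hql, w, hw, hqw⟩ := L.cycle_eq_triangle q hq
  have hverts : ∀ {u : V} (p : G.Walk u u), p.toSubgraph.verts = {x | x ∈ p.support} := by
    intro u p
    ext x
    exact p.mem_verts_toSubgraph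
  rw [hverts, hverts, hpv, hqw]
  refine L.subsingleton_inter_triangle hv hw fun h => hpq ?_
  have hs : ∀ x, x ∈ p.support ↔ x ∈ q.support := by
    have h' : {x | x ∈ p.support} = {x | x ∈ q.support} := hpv.trans (h.trans hqw.symm)
    exact fun x => Set.ext_iff.1 h' x
  refine Subgraph.ext ?_ ?_
  · rw [hverts, hverts, hpv, hqw, h]
  · ext x y
    rw [p.toSubgraph_adj_of_length_three hpl, q.toSubgraph_adj_of_length_three hql, hs, hs]

end SimpleGraph


/-! ### Every triangular cactus is layered by distance to the root -/

namespace SimpleGraph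

variable {V : Type*} {G : SimpleGraph V} {r : V}

/-- Closing the path through `v` gives a cycle with two more edges, and that cycle has length three.
-/
theorem length_eq_one_of_cycles (hG : ∀ (u : V) (p : G.Walk u u), p.IsCycle → p.length = 3)
    {v u w : V} (hu : G.Adj v u) (hw : G.Adj v w) (huw : u ≠ w) {p : G.Walk u w} (hp : p.IsPath)
    (hv : v ∉ p.support) : p.length = 1 := by
  have hc : (Walk.cons hu (p.concat hw.symm)).IsCycle := by
    rw [Walk.cons_isCycle_iff]
    refine ⟨hp.concat hv hw.symm, fun h => ?_⟩
    rw [Walk.edges_concat, List.concat_eq_append, List.mem_append, List.mem_singleton] at h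
    rcases h with h | h
    · exact hv (p.fst_mem_support_of_mem_edges h)
    · rcases Sym2.eq_iff.1 h with ⟨h1, -⟩ | ⟨-, h2⟩
      · exact hw.ne h1
      · exact huw h2
  have := hG _ _ hc
  rw [Walk.length_cons, Walk.length_concat] at this
  omega

theorem adj_of_cycles (hG : ∀ (u : V) (p : G.Walk u u), p.IsCycle → p.length = 3)
    {v u w : V} (hu : G.Adj v u) (hw : G.Adj v w) (huw : u ≠ w) (p : G.Walk u w)
    (hv : v ∉ p.support) : G.Adj u w := by
  classical
  exact Walk.adj_of_length_eq_one (length_eq_one_of_cycles hG hu hw huw p.bypass_isPath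
    fun h => hv (p.support_bypass_subset_support h))

/-- A graph all of whose cycles are triangles has no cycle with four vertices. -/
theorem false_of_four_cycle (hG : ∀ (u : V) (p : G.Walk u u), p.IsCycle → p.length = 3)
    {a b c d : V} (hab : G.Adj a b) (hbc : G.Adj b c) (hcd : G.Adj c d) (hda : G.Adj d a)
    (hac : a ≠ c) (hbd : b ≠ d) : False := by
  have hp : (Walk.cons hbc (Walk.cons hcd Walk.nil)).IsPath := by
    simp [Walk.isPath_def, hbc.ne, hcd.ne, hbd]
  have h := length_eq_one_of_cycles hG hab hda.symm hbd hp (by simp [hab.ne, hac, hda.ne.symm])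
  simp at h

theorem Connected.exists_adj_dist (hc : G.Connected) (r : V) {v : V} (hv : v ≠ r) :
    ∃ u, G.Adj v u ∧ G.dist u r + 1 = G.dist v r := by
  obtain ⟨p, hp⟩ := hc.exists_walk_length_eq_dist v r
  cases p with
  | nil => exact absurd rfl hv
  | @cons _ u _ h p =>
    refine ⟨u, h, ?_⟩
    have h1 := dist_le p
    have h2 := hc.dist_triangle (u := v) (v := u) (w := r)
    rw [Walk.length_cons] at hp
    rw [dist_eq_one_iff_adj.2 h] at h2
    omega

theorem Connected.exists_walk_dist_lt (hc : G.Connected) (r v : V) :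
    ∃ p : G.Walk v r, ∀ x ∈ p.support, x = v ∨ G.dist x r < G.dist v r := by
  induction h : G.dist v r using Nat.strong_induction_on generalizing v with
  | _ k ih =>
    by_cases hv : v = r
    · subst hv
      exact ⟨.nil, by simp⟩
    · obtain ⟨u, hu, hd⟩ := hc.exists_adj_dist r hv
      obtain ⟨p, hp⟩ := ih (G.dist u r) (by omega) u rfl
      refine ⟨.cons hu p, fun x hx => ?_⟩
      rw [Walk.support_cons, List.mem_cons] at hx
      rcases hx with hx | hx
      · exact Or.inl hx
      · right
        rcases hp x hx with rfl | h'
        · omega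
        · omega

/-- Two vertices are joined by a walk that avoids a given vertex not closer to the root. -/
theorem Connected.exists_walk_avoiding (hc : G.Connected) (r : V) {u w v : V} (hu : u ≠ v)
    (hw : w ≠ v) (hu' : G.dist u r ≤ G.dist v r) (hw' : G.dist w r ≤ G.dist v r) :
    ∃ p : G.Walk u w, v ∉ p.support := by
  obtain ⟨p, hp⟩ := hc.exists_walk_dist_lt r u
  obtain ⟨q, hq⟩ := hc.exists_walk_dist_lt r w
  refine ⟨p.append q.reverse, fun h => ?_⟩
  rw [Walk.mem_support_append_iff, Walk.support_reverse, List.mem_reverse] at h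
  rcases h with h | h
  · rcases hp v h with h' | h'
    · exact hu h'.symm
    · omega
  · rcases hq v h with h' | h'
    · exact hw h'.symm
    · omega

section Layers

variable (hc : G.Connected) (hG : ∀ (u : V) (p : G.Walk u u), p.IsCycle → p.length = 3)

include hc hG

theorem adj_parent_of_same_layer {u w p : V} (huw : G.Adj u w) (hd : G.dist u r = G.dist w r)
    (hp : G.Adj w p) (hpd : G.dist p r + 1 = G.dist w r) : G.Adj u p := by
  have hup : u ≠ p := by
    rintro rfl
    omega
  obtain ⟨q, hq⟩ := hc.exists_walk_avoiding r huw.ne hp.ne.symm hd.le (by omega)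
  exact adj_of_cycles hG huw.symm hp hup q hq

/-- Two parents of `v` are joined by a walk avoiding `v`, hence adjacent. A parent `p` of `w` is
then adjacent to `u` as well, and `v, u, p, w` form a 4-cycle. -/
theorem parent_unique {v u w : V} (hu : G.Adj v u) (hw : G.Adj v w)
    (hud : G.dist u r + 1 = G.dist v r) (hwd : G.dist w r + 1 = G.dist v r) : u = w := by
  by_contra huw
  obtain ⟨q, hq⟩ := hc.exists_walk_avoiding r hu.ne.symm hw.ne.symm (by omega : G.dist u r ≤ _)
    (by omega)
  have h := adj_of_cycles hG hu hw huw q hq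
  have hwr : w ≠ r := by
    rintro rfl
    rw [dist_self] at hwd
    have : G.dist u w = 0 := by omega
    exact huw (hc.dist_eq_zero_iff.1 this)
  obtain ⟨p, hp, hpd⟩ := hc.exists_adj_dist r hwr
  have hup := adj_parent_of_same_layer hc hG h (by omega) hp hpd
  refine false_of_four_cycle hG hu hup hp.symm hw.symm ?_ huw
  rintro rfl
  omega

/-- A parent `p` of `v` is adjacent to every neighbour of `v` in its layer, so two such neighbours
give the 4-cycle `v, u, p, w`. -/
theorem mate_unique {v u w : V} (hu : G.Adj v u) (hw : G.Adj v w)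
    (hud : G.dist u r = G.dist v r) (hwd : G.dist w r = G.dist v r) : u = w := by
  by_contra huw
  have hvr : v ≠ r := by
    rintro rfl
    rw [dist_self] at hud
    exact hu.ne (hc.dist_eq_zero_iff.1 hud).symm
  obtain ⟨p, hp, hpd⟩ := hc.exists_adj_dist r hvr
  have hup := adj_parent_of_same_layer hc hG hu.symm hud hp hpd
  have hwp := adj_parent_of_same_layer hc hG hw.symm hwd hp hpd
  exact false_of_four_cycle hG hu hup hwp.symm hw.symm hp.ne huw

theorem nonempty_triangleLayering (r : V) : Nonempty (G.TriangleLayering r) := by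
  classical
  have hpar : ∀ v, ∃ p, v ≠ r → G.Adj v p ∧ G.dist p r + 1 = G.dist v r := by
    intro v
    by_cases hv : v = r
    · exact ⟨v, fun h => absurd hv h⟩
    · obtain ⟨p, hp⟩ := hc.exists_adj_dist r hv
      exact ⟨p, fun _ => hp⟩
  choose par hpar using hpar
  have hmate : ∀ v, ∃ m, G.dist m r = G.dist v r ∧ (m ≠ v → G.Adj v m) ∧
      ∀ w, G.Adj v w → G.dist w r = G.dist v r → w = m := by
    intro v
    by_cases h : ∃ m, G.Adj v m ∧ G.dist m r = G.dist v r
    · obtain ⟨m, hm, hmd⟩ := h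
      exact ⟨m, hmd, fun _ => hm, fun w hw hwd => mate_unique hc hG hw hm hwd hmd⟩
    · exact ⟨v, rfl, fun h => absurd rfl h, fun w hw hwd => absurd ⟨w, hw, hwd⟩ h⟩
  choose mate hmd hma hmu using hmate
  have hmm : ∀ v, mate (mate v) = v := by
    intro v
    by_cases h : mate v = v
    · rw [h, h]
    · exact (hmu (mate v) v (hma v h).symm (hmd v).symm).symm
  refine ⟨⟨fun v => G.dist v r, par, mate, dist_self, fun v hv => (hpar v hv).1,
    fun v hv => (hpar v hv).2, hmm, hmd, fun v hv => ?_, hma, fun v w hvw hd => ?_⟩⟩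
  · by_cases h : mate v = v
    · rw [h]
    · have h1 := hpar v hv
      have hmr : mate v ≠ r := by
        intro h'
        have := hmd v
        rw [h', dist_self] at this
        exact hv (hc.dist_eq_zero_iff.1 this.symm)
      have h2 := hpar (mate v) hmr
      have h3 := adj_parent_of_same_layer hc hG (hma v h).symm (hmd v) h1.1 h1.2
      exact parent_unique hc hG h2.1 h3 h2.2 (by rw [h1.2, hmd])
  · have hd : G.dist w r ≤ G.dist v r := hd
    rcases hd.eq_or_lt with hd | hd
    · exact Or.inr (hmu v w hvw hd)
    · left
      have hvr : v ≠ r := by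
        rintro rfl
        rw [dist_self] at hd
        omega
      have h1 := hpar v hvr
      refine parent_unique hc hG hvw h1.1 ?_ h1.2
      have h2 := hc.dist_triangle (u := v) (v := w) (w := r)
      rw [dist_eq_one_iff_adj.2 hvw] at h2
      omega

end Layers

end SimpleGraph


/-! ### The cactus of a signed forest -/

namespace SignedRootedForest

variable {n : ℕ}

/-- `o` is one of the two vertices over `c`, and `o'` is the other one or the vertex `up c`. -/
def CactusStep (T : SignedRootedForest n) (o o' : Option (Fin n × ℤˣ)) : Prop :=
  ∃ c s, o = some (c, s) ∧ (o' = T.up c ∨ o' = some (c, -s))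

/-- The cactus of a signed rooted forest: each vertex `c` of the forest becomes a triangle with
vertices `up c`, `(c, 1)` and `(c, -1)`. -/
def cactusGraph (T : SignedRootedForest n) : SimpleGraph (Option (Fin n × ℤˣ)) :=
  SimpleGraph.fromRel T.CactusStep

/-- The height of a vertex of the cactus. -/
noncomputable def cactusDepth (T : SignedRootedForest n) : Option (Fin n × ℤˣ) → ℕ
  | none => 0
  | some (c, _) => T.height c

/-- The lowest vertex of the triangle above a vertex. -/
def cactusPar (T : SignedRootedForest n) : Option (Fin n × ℤˣ) → Option (Fin n × ℤˣ)
  | none => none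
  | some (c, _) => T.up c

/-- The other upper vertex of the triangle above a vertex. -/
def cactusMate : Option (Fin n × ℤˣ) → Option (Fin n × ℤˣ)
  | none => none
  | some (c, s) => some (c, -s)

theorem cactusDepth_up (T : SignedRootedForest n) (c : Fin n) :
    T.cactusDepth (T.up c) + 1 = T.height c := by
  rcases h : T.up c with _ | ⟨p, s⟩
  · rw [T.height_of_root h]
    rfl
  · rw [T.height_of_up h]
    rfl

theorem cactusMate_ne {o : Option (Fin n × ℤˣ)} (h : o ≠ none) : cactusMate o ≠ o := by
  rcases o with _ | ⟨c, s⟩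
  · exact absurd rfl h
  · simp [cactusMate]

/-- The layers of the cactus of a forest. -/
noncomputable def cactusLayering (T : SignedRootedForest n) :
    T.cactusGraph.TriangleLayering none where
  depth := T.cactusDepth
  par := T.cactusPar
  mate := cactusMate
  depth_root := rfl
  adj_par := by
    rintro (_ | ⟨c, s⟩) h
    · exact absurd rfl h
    · refine ⟨fun h' => ?_, Or.inl ⟨c, s, rfl, Or.inl rfl⟩⟩
      have h1 := T.cactusDepth_up c
      change some (c, s) = T.up c at h'
      rw [← h'] at h1
      simp [cactusDepth] at h1
  depth_par := by
    rintro (_ | ⟨c, s⟩) h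
    · exact absurd rfl h
    · exact T.cactusDepth_up c
  mate_mate := by
    rintro (_ | ⟨c, s⟩) <;> simp [cactusMate]
  depth_mate := by
    rintro (_ | ⟨c, s⟩) <;> rfl
  par_mate := by
    rintro (_ | ⟨c, s⟩) _ <;> rfl
  adj_mate := by
    rintro (_ | ⟨c, s⟩) h
    · exact absurd rfl h
    · exact ⟨h.symm, Or.inl ⟨c, s, rfl, Or.inr rfl⟩⟩
  adj_cases := by
    rintro v w ⟨-, ⟨c, s, rfl, h⟩ | ⟨c, s, rfl, h⟩⟩ hd
    · exact h
    · rcases h with rfl | rfl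
      · have := T.cactusDepth_up c
        change T.height c ≤ _ at hd
        omega
      · exact Or.inr (by simp [cactusMate])

theorem cactusStep_twist {T T' : SignedRootedForest n} {π : Equiv.Perm (Fin n)}
    {ε : Fin n → ℤˣ} (h : ∀ c, T'.up (π c) = twist π ε (T.up c)) (o o' : Option (Fin n × ℤˣ)) :
    T'.CactusStep (twist π ε o) (twist π ε o') ↔ T.CactusStep o o' := by
  have hinj := twist_injective ε π.injective
  have hneg : ∀ c s, some (π c, -(ε c * s)) = twist π ε (some (c, -s)) := by simp
  constructor
  · rintro ⟨c', s', ho, ho'⟩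
    rcases o with _ | ⟨c, s⟩
    · simp at ho
    · rw [twist_some, Option.some.injEq, Prod.mk.injEq] at ho
      obtain ⟨rfl, rfl⟩ := ho
      refine ⟨c, s, rfl, ?_⟩
      rwa [h, hneg, hinj.eq_iff, hinj.eq_iff] at ho'
  · rintro ⟨c, s, rfl, ho'⟩
    refine ⟨π c, ε c * s, rfl, ?_⟩
    rwa [h, hneg, hinj.eq_iff, hinj.eq_iff]

/-- A twist acts on the cactus by `twist π ε`, fixing `none`. Conversely, a rooted isomorphism
preserves mates, so it has the form `(c, s) ↦ (π c, ε c * s)`, with `(π c, ε c)` the image of `(c,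
1)`; preservation of `par` is the twist equation. -/
theorem twisted_iff_cactusGraph_iso (T T' : SignedRootedForest n) :
    T.Twisted T' ↔ ∃ e : T.cactusGraph ≃g T'.cactusGraph, e none = none := by
  constructor
  · rintro ⟨π, ε, h⟩
    have hinj := twist_injective ε π.injective
    refine ⟨⟨Equiv.ofBijective (twist π ε) (Finite.injective_iff_bijective.1 hinj), ?_⟩, rfl⟩
    intro o o'
    simp only [cactusGraph, SimpleGraph.fromRel_adj, Equiv.ofBijective_apply, hinj.ne_iff,
      cactusStep_twist h]
  · rintro ⟨e, he⟩
    have h1 : ∀ c, ∃ w : Fin n × ℤˣ, e (some (c, 1)) = some w := by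
      intro c
      refine Option.ne_none_iff_exists'.1 fun h => ?_
      have := e.injective (h.trans he.symm)
      simp at this
    choose w hw using h1
    have hs : ∀ c s, e (some (c, s)) = some ((w c).1, (w c).2 * s) := by
      intro c s
      rcases Int.units_eq_one_or s with rfl | rfl
      · rw [hw, mul_one]
      · have := T.cactusLayering.mate_map T'.cactusLayering e he (v := some (c, 1))
          (cactusMate_ne (o := some (c, 1)) (by simp))
        rw [hw] at this
        simpa [cactusLayering, cactusMate] using this.symm
    have hinj : Function.Injective fun c => (w c).1 := by
      intro c d hcd
      -- These signs are chosen so that both images are the same vertex with sign `1`.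
      have h2 : e (some (c, (w c).2)) = e (some (d, (w d).2)) := by
        rw [hs, hs, Int.units_mul_self, Int.units_mul_self, show (w c).1 = (w d).1 from hcd]
      have := e.injective h2
      simp only [Option.some.injEq, Prod.mk.injEq] at this
      exact this.1
    refine ⟨Equiv.ofBijective _ (Finite.injective_iff_bijective.1 hinj), fun c => (w c).2,
      fun c => ?_⟩
    have h3 := T.cactusLayering.par_map T'.cactusLayering e he (v := some (c, 1)) (by simp)
    rw [hw] at h3
    change T'.up (w c).1 = e (T.up c) at h3
    rw [Equiv.ofBijective_apply, h3]
    rcases T.up c with _ | ⟨p, s⟩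
    · exact he
    · exact hs p s

/-- A numbering of the vertices of the cactus of a forest on `n` vertices. -/
noncomputable def cactusLabel (n : ℕ) : Option (Fin n × ℤˣ) ≃ Fin (2 * n + 1) :=
  Fintype.equivFinOfCardEq (by simp [mul_comm])

end SignedRootedForest

/-- Transport a layering along an isomorphism. -/
def SimpleGraph.TriangleLayering.map {V V' : Type*} {G : SimpleGraph V} {G' : SimpleGraph V'}
    {r : V} (L : G.TriangleLayering r) (e : G ≃g G') : G'.TriangleLayering (e r) where
  depth v := L.depth (e.symm v)
  par v := e (L.par (e.symm v))
  mate v := e (L.mate (e.symm v))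
  depth_root := by simp [L.depth_root]
  adj_par v hv := by
    have := L.adj_par (e.symm v) fun h => hv (by rw [← h, e.apply_symm_apply])
    simpa using e.map_adj_iff.2 this
  depth_par v hv := by
    have := L.depth_par (e.symm v) fun h => hv (by rw [← h, e.apply_symm_apply])
    simpa using this
  mate_mate v := by simp [L.mate_mate]
  depth_mate v := by simp [L.depth_mate]
  par_mate v hv := by
    have := L.par_mate (e.symm v) fun h => hv (by rw [← h, e.apply_symm_apply])
    simp [this]
  adj_mate v hv := by
    have := L.adj_mate (e.symm v) fun h => hv (by rw [h, e.apply_symm_apply])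
    simpa using e.map_adj_iff.2 this
  adj_cases v w hvw hd := by
    have := L.adj_cases _ _ (e.symm.map_adj_iff.2 hvw) hd
    rwa [e.symm_apply_eq, e.symm_apply_eq] at this

namespace SignedRootedForest

variable {n : ℕ}

/-- The cactus of a forest, on numbered vertices. -/
noncomputable def labelledCactusGraph (T : SignedRootedForest n) :
    SimpleGraph (Fin (2 * n + 1)) :=
  T.cactusGraph.comap (cactusLabel n).symm

/-- The numbering of the vertices of the cactus as an isomorphism of graphs. -/
noncomputable def cactusIso (T : SignedRootedForest n) : T.cactusGraph ≃g T.labelledCactusGraph :=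
  (SimpleGraph.Iso.comap (cactusLabel n).symm T.cactusGraph).symm

theorem card_triangles_labelledCactusGraph (T : SignedRootedForest n) :
    {t : Finset (Fin (2 * n + 1)) | T.labelledCactusGraph.IsNClique 3 t}.ncard = n := by
  let L := T.cactusLayering.map T.cactusIso
  have hm : ∀ c s, L.mate (T.cactusIso (some (c, s))) = T.cactusIso (some (c, -s)) := by
    intro c s
    simp [L, SimpleGraph.TriangleLayering.map, cactusLayering, cactusMate]
  have hne : ∀ c s, L.mate (T.cactusIso (some (c, s))) ≠ T.cactusIso (some (c, s)) := by
    intro c s h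
    rw [hm] at h
    have := T.cactusIso.injective h
    simp only [Option.some.injEq, Prod.mk.injEq, true_and] at this
    simp at this
  let f : Fin n → Finset (Fin (2 * n + 1)) := fun c =>
    (Set.toFinite (L.triangle (T.cactusIso (some (c, 1))))).toFinset
  have hf : ∀ c, (f c : Set (Fin (2 * n + 1))) = L.triangle (T.cactusIso (some (c, 1))) :=
    fun c => Set.Finite.coe_toFinset _
  have hinj : Function.Injective f := by
    intro c d hcd
    have h1 : L.triangle (T.cactusIso (some (c, 1))) = L.triangle (T.cactusIso (some (d, 1))) := by
      rw [← hf, ← hf, hcd]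
    rcases L.eq_or_eq_mate_of_triangle_eq (hne c 1) (hne d 1) h1 with h | h
    · have := T.cactusIso.injective h
      simpa using this
    · rw [hm] at h
      have := T.cactusIso.injective h
      simp only [Option.some.injEq, Prod.mk.injEq] at this
      exact this.1
  have hrange : {t : Finset (Fin (2 * n + 1)) | T.labelledCactusGraph.IsNClique 3 t} =
      Set.range f := by
    ext t
    refine L.isNClique_iff.trans ⟨?_, ?_⟩
    · rintro ⟨v, hv, ht⟩
      obtain ⟨_ | ⟨c, s⟩, rfl⟩ := T.cactusIso.surjective v
      · exact absurd L.mate_root hv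
      · refine ⟨c, Finset.coe_injective ?_⟩
        rw [hf, ht]
        rcases Int.units_eq_one_or s with rfl | rfl
        · rfl
        · rw [← hm, L.triangle_mate (hne c 1)]
    · rintro ⟨c, rfl⟩
      exact ⟨_, hne c 1, hf c⟩
  rw [hrange, ← Set.image_univ, Set.ncard_image_of_injective _ hinj, Set.ncard_univ,
    Nat.card_eq_fintype_card, Fintype.card_fin]

/-- The rooted triangular cactus of a signed rooted forest. -/
noncomputable def toCactus (T : SignedRootedForest n) : RootedTriangularCactus n where
  graph := T.labelledCactusGraph
  root := T.cactusIso none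
  isTriangularCactus := (T.cactusLayering.map T.cactusIso).isTriangularCactus
  card_triangles := T.card_triangles_labelledCactusGraph

theorem twisted_iff_toCactus_iso (T T' : SignedRootedForest n) :
    T.Twisted T' ↔ T.toCactus.Iso T'.toCactus := by
  rw [twisted_iff_cactusGraph_iso]
  constructor
  · rintro ⟨e, he⟩
    refine ⟨(T.cactusIso.symm.trans e).trans T'.cactusIso, ?_⟩
    change T'.cactusIso (e (T.cactusIso.symm (T.cactusIso none))) = T'.cactusIso none
    rw [RelIso.symm_apply_apply, he]
  · rintro ⟨e, he⟩
    refine ⟨(T.cactusIso.trans e).trans T'.cactusIso.symm, ?_⟩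
    change T'.cactusIso.symm (e (T.cactusIso none)) = none
    rw [show e (T.cactusIso none) = T'.cactusIso none from he, RelIso.symm_apply_apply]

/-- The triangles of `C` serve as forest vertices. In each, one upper vertex is named `(c, 1)` and
its mate `(c, -1)`; the other choice would amount to a flip at `c`. The parent of `c` is the name of
the lowest vertex of its triangle. -/
theorem exists_toCactus_iso (C : RootedTriangularCactus n) :
    ∃ T : SignedRootedForest n, T.toCactus.Iso C := by
  obtain ⟨L⟩ := SimpleGraph.nonempty_triangleLayering C.isTriangularCactus.1
    C.isTriangularCactus.2.2 C.root
  have hcard := C.card_triangles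
  rw [← Nat.card_coe_set_eq] at hcard
  have e := (Finite.equivFinOfCardEq hcard).symm
  have ht : ∀ c, ∃ v, L.mate v ≠ v ∧ ((e c).1 : Set (Fin (2 * n + 1))) = L.triangle v :=
    fun c => L.isNClique_iff.1 (e c).2
  choose v hv hvt using ht
  let φ : Option (Fin n × ℤˣ) → Fin (2 * n + 1)
    | none => C.root
    | some (c, s) => if s = 1 then v c else L.mate (v c)
  have hφmate : ∀ c s, φ (some (c, -s)) = L.mate (φ (some (c, s))) := by
    intro c s
    rcases Int.units_eq_one_or s with rfl | rfl
    · simp [φ]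
    · simp [φ, L.mate_mate]
  have hφne : ∀ c s, L.mate (φ (some (c, s))) ≠ φ (some (c, s)) := by
    intro c s
    rcases Int.units_eq_one_or s with rfl | rfl
    · simpa [φ] using hv c
    · simpa [φ] using L.mate_mate_ne (hv c)
  have hφt : ∀ c s, L.triangle (φ (some (c, s))) = (e c).1 := by
    intro c s
    rw [hvt]
    rcases Int.units_eq_one_or s with rfl | rfl
    · simp [φ]
    · simpa [φ] using L.triangle_mate (hv c)
  have hφinj : Function.Injective φ := by
    rintro (_ | ⟨c, s⟩) (_ | ⟨d, t⟩) h
    · rfl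
    · exact absurd h.symm (L.ne_root (hφne d t))
    · exact absurd h (L.ne_root (hφne c s))
    · have h1 : (e c).1 = (e d).1 := by
        apply Finset.coe_injective
        rw [← hφt c s, ← hφt d t, h]
      obtain rfl := e.injective (Subtype.ext h1)
      by_cases hst : s = t
      · rw [hst]
      · exfalso
        have hst' : t = -s := by
          rcases Int.units_eq_one_or s with rfl | rfl <;>
            rcases Int.units_eq_one_or t with rfl | rfl <;> simp_all
        rw [hst', hφmate] at h
        exact hφne c s h.symm
  -- The `2n` upper vertices and the root are all `2n + 1` vertices, so every other vertex than the
  -- root has a mate and every lowest vertex has a name.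
  let Φ : Option (Fin n × ℤˣ) ≃ Fin (2 * n + 1) := Equiv.ofBijective φ
    ((Fintype.bijective_iff_injective_and_card φ).2 ⟨hφinj, by simp [mul_comm]⟩)
  have hΦ : ∀ o, Φ o = φ o := fun _ => rfl
  have hpar : ∀ c s, L.par (φ (some (c, s))) = L.par (v c) := by
    intro c s
    rcases Int.units_eq_one_or s with rfl | rfl
    · simp [φ]
    · simpa [φ] using L.par_mate _ (L.ne_root (hv c))
  let up : Fin n → Option (Fin n × ℤˣ) := fun c => Φ.symm (L.par (v c))
  have hup : ∀ c, φ (up c) = L.par (v c) := fun c => Φ.apply_symm_apply _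
  have hwf : IsParentFun up := by
    refine ⟨fun c => L.depth (v c), fun c p s h => ?_⟩
    have h1 := hup c
    rw [h] at h1
    have h2 := L.depth_par (v c) (L.ne_root (hv c))
    have h3 : L.depth (φ (some (p, s))) = L.depth (v p) := by
      rcases Int.units_eq_one_or s with rfl | rfl
      · simp [φ]
      · simp [φ, L.depth_mate]
    rw [← h1, h3] at h2
    dsimp only
    omega
  let T : SignedRootedForest n := ⟨up, hwf.wf⟩
  have hstep : ∀ o o', T.CactusStep o o' → C.graph.Adj (φ o) (φ o') := by
    rintro o o' ⟨c, s, rfl, rfl | rfl⟩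
    · change C.graph.Adj _ (φ (up c))
      rw [hup, ← hpar c s]
      exact L.adj_par _ (L.ne_root (hφne c s))
    · rw [hφmate]
      exact L.adj_mate _ (hφne c s)
  have hstep' : ∀ o o', C.graph.Adj (φ o) (φ o') → L.depth (φ o') ≤ L.depth (φ o) →
      T.CactusStep o o' := by
    intro o o' h hd
    -- The root has no neighbour at depth at most `0`, since only the root has depth `0`.
    rcases o with _ | ⟨c, s⟩
    · exfalso
      have h0 : L.depth (φ none) = 0 := L.depth_root
      rw [h0] at hd
      exact h.ne (L.eq_root (Nat.le_zero.1 hd)).symm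
    · refine ⟨c, s, rfl, ?_⟩
      rcases L.adj_cases _ _ h hd with h' | h'
      · left
        apply hφinj
        rw [h', hpar]
        exact (hup c).symm
      · right
        apply hφinj
        rw [h', hφmate]
  have hadj : ∀ o o', C.graph.Adj (Φ o) (Φ o') ↔ T.cactusGraph.Adj o o' := by
    intro o o'
    rw [hΦ, hΦ]
    constructor
    · intro h
      refine ⟨fun h' => h.ne (congrArg φ h'), ?_⟩
      rcases le_total (L.depth (φ o')) (L.depth (φ o)) with hd | hd
      · exact Or.inl (hstep' _ _ h hd)
      · exact Or.inr (hstep' _ _ h.symm hd)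
    · rintro ⟨-, h | h⟩
      · exact hstep _ _ h
      · exact (hstep _ _ h).symm
  let E : T.cactusGraph ≃g C.graph := ⟨Φ, fun {o o'} => hadj o o'⟩
  refine ⟨T, T.cactusIso.symm.trans E, ?_⟩
  change E (T.cactusIso.symm (T.cactusIso none)) = C.root
  rw [RelIso.symm_apply_apply]
  rfl

end SignedRootedForest

theorem forestClassCount_eq_rootedTriangularCactusCount (n : ℕ) :
    forestClassCount n = rootedTriangularCactusCount n := by
  refine SignedRootedForest.forestClassCount_eq_card
    (fun T => Quotient.mk (RootedTriangularCactus.isoSetoid n) T.toCactus) (fun T T' => ?_) ?_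
  · rw [T.twisted_iff_toCactus_iso]
    exact (Quotient.eq (r := RootedTriangularCactus.isoSetoid n)).symm
  · rintro ⟨C⟩
    obtain ⟨T, hT⟩ := SignedRootedForest.exists_toCactus_iso C
    exact ⟨T, Quotient.sound hT⟩

theorem mainTheorem1 :
    SatisfiesFunctionalEquation forestSeries ∧
    (∀ G : PowerSeries ℚ, SatisfiesFunctionalEquation G → G = forestSeries) ∧
    (forestClassCount 0 = 1 ∧ forestClassCount 1 = 1 ∧ forestClassCount 2 = 2 ∧
      forestClassCount 3 = 5 ∧ forestClassCount 4 = 13 ∧ forestClassCount 5 = 37 ∧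
      forestClassCount 6 = 111 ∧ forestClassCount 7 = 345 ∧ forestClassCount 8 = 1105 ∧
      forestClassCount 9 = 3624 ∧ forestClassCount 10 = 12099) ∧
    ∀ n : ℕ, forestClassCount n = rootedTriangularCactusCount n := by
  have hcoeff : (fun n => PowerSeries.coeff n forestSeries) =
      fun n => (forestClassCount n : ℚ) := by
    funext n
    rw [forestSeries, PowerSeries.coeff_mk]
  have hrec : ForestRecursion fun n => PowerSeries.coeff n forestSeries := by
    rw [hcoeff]
    exact forestRecursion_forestClassCount
  refine ⟨(satisfiesFunctionalEquation_iff _).2 hrec, fun G hG => ?_, ?_,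
    forestClassCount_eq_rootedTriangularCactusCount⟩
  · ext n
    exact ((satisfiesFunctionalEquation_iff G).1 hG).unique hrec n
  · exact_mod_cast forestRecursion_forestClassCount.values
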